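/- Let $X$ be a paracompact, locally contractible Hausdorff space, and let $E\subset X\times\mathbb C$ be a closed subset such that the first projection $q=p_1|_E:E\to X$ is a countably infinite-sheeted covering. For $U\subset X$ open let $\mathcal O(U)$ be the ring of continuous functions $h:U\times\mathbb C\to\mathbb C$ with $h(x,\cdot)$ entire for every $x\in U$, and let $\mathcal O^\times(U)$ be the group of its nowhere-vanishing elements, so that $$0\to\mathbb Z\xrightarrow{\;2\pi i\;}\mathcal O\xrightarrow{\;\exp\;}\mathcal O^\times\to 1$$ is an exact sequence of sheaves, with connecting homomorphism $\delta:H^1(X;\mathcal O^\times)\to H^2(X;\mathbb Z)$ (Čech cohomology). A local realization of $E$ over $U$ is an $F\in\mathcal O(U)$ such that $F(x,\cdot)$ has only simple zeros for every $x\in U$ and $\{(x,z)\in U\times\mathbb C: F(x,z)=0\}=E\cap(U\times\mathbb C)$. For example, if $E\cap (U\times\mathbb C)$ is the disjoint union of the graphs of continuous functions $s_n:U\to\mathbb C$, $n\ge1$, all of which avoid a constant $c\in\mathbb C$, one may take the Weierstrass product $F(x,z)=\prod_{n\ge1}\mathcal E_n\bigl(\tfrac{z-c}{s_n(x)-c}\bigr)$,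 where $\mathcal E_p(w)=(1-w)\exp\bigl(w+\tfrac{w^2}{2}+\dots+\tfrac{w^p}{p}\bigr)$. (1) There are an open cover $\{U_i\}$ of $X$ and Weierstrass products $F_i$ for $E$ over $U_i$. For every open cover $\{U_i\}$ and all local realizations $F_i$ of $E$ over $U_i$, the ratios $h_{ij}=F_i/F_j$ extend to a Čech $1$-cocycle with values in $\mathcal O^\times$, and the class $c_1(E):=\delta([h_{ij}])\in H^2(X;\mathbb Z)$ does not depend on the cover or on the $F_i$. (2) $c_1(E)=0$ if and only if there is a continuous function $F:X\times\mathbb C\to\mathbb C$ such that $F(x,\cdot)$ is entire with only simple zeros for every $x\in X$ and $\{(x,z): F(x,z)=0\}=E$. (3) In particular, if $H^2(X;\mathbb Z)=0$, then every such $E$ is the zero locus of such an $F$. -/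

import Mathlib

noncomputable section

open CategoryTheory TopologicalSpace Opposite

universe u

namespace WeierstrassCovering

/-! ### Čech cohomology of a topological space with coefficients in an abelian presheaf -/

section Cech

variable {X : Type u} [TopologicalSpace X]

/-- Restriction of sections of an abelian presheaf. -/
def res (P : (Opens X)ᵒᵖ ⥤ AddCommGrpCat.{u}) {U V : Opens X} (h : V ≤ U) :
    P.obj (op U) →+ P.obj (op V) :=
  (P.map (homOfLE h).op).hom

theorem res_res (P : (Opens X)ᵒᵖ ⥤ AddCommGrpCat.{u}) {U V W : Opens X} (h : V ≤ U) (k : W ≤ V)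
    (a : P.obj (op U)) : res P k (res P h a) = res P (k.trans h) a := by
  have e : (homOfLE (k.trans h)).op = (homOfLE h).op ≫ (homOfLE k).op := rfl
  simp only [res, e, P.map_comp]
  rfl

theorem res_self (P : (Opens X)ᵒᵖ ⥤ AddCommGrpCat.{u}) {U : Opens X} (h : U ≤ U)
    (a : P.obj (op U)) : res P h a = a := by
  have e : (homOfLE h).op = 𝟙 (op U) := rfl
  simp only [res, e, P.map_id]
  rfl

variable (X) in
/-- An open cover indexed by the points of the space, the set with index `x` containing `x`.
Every open cover is refined by one of this form, so the limit over these covers is the usual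
Čech cohomology; and between two of them there is at most one refinement that fixes the indices. -/
@[ext]
structure PointCover where
  set : X → Opens X
  mem : ∀ x, x ∈ set x

namespace PointCover

/-- `U ≤ V` means that `V` refines `U`. -/
instance : PartialOrder (PointCover X) where
  le U V := ∀ x, V.set x ≤ U.set x
  le_refl _ _ := le_rfl
  le_trans _ _ _ h k x := (k x).trans (h x)
  le_antisymm _ _ h k := PointCover.ext (funext fun x => le_antisymm (k x) (h x))

instance : Nonempty (PointCover X) := ⟨⟨fun _ => ⊤, fun _ => trivial⟩⟩

instance : IsDirectedOrder (PointCover X) where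
  directed U V := ⟨⟨fun x => U.set x ⊓ V.set x, fun x => ⟨U.mem x, V.mem x⟩⟩,
    fun _ => inf_le_left, fun _ => inf_le_right⟩

instance : DecidableEq (PointCover X) := Classical.decEq _

/-- The intersection `U_{x₀} ∩ ⋯ ∩ U_{xₙ}`. -/
def inter (U : PointCover X) {n : ℕ} (s : Fin (n + 1) → X) : Opens X := ⨅ i, U.set (s i)

theorem inter_le (U : PointCover X) {n : ℕ} (s : Fin (n + 1) → X) (i : Fin (n + 1)) :
    U.inter s ≤ U.set (s i) := iInf_le _ i

theorem inter_le_face (U : PointCover X) {n : ℕ} (s : Fin (n + 2) → X) (i : Fin (n + 2)) :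
    U.inter s ≤ U.inter (s ∘ i.succAbove) := le_iInf fun j => iInf_le _ (i.succAbove j)

theorem inter_mono {U V : PointCover X} (h : U ≤ V) {n : ℕ} (s : Fin (n + 1) → X) :
    V.inter s ≤ U.inter s := iInf_mono fun i => h (s i)

end PointCover

variable (P : (Opens X)ᵒᵖ ⥤ AddCommGrpCat.{u}) (U : PointCover X)

/-- Čech `n`-cochains of the cover `U` with values in `P`. -/
abbrev Cochain (n : ℕ) : Type u := ∀ s : Fin (n + 1) → X, P.obj (op (U.inter s))

/-- The Čech differential, the alternating sum of the restricted faces. -/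
def d (n : ℕ) : Cochain P U n →+ Cochain P U (n + 1) where
  toFun c s := ∑ i : Fin (n + 2),
    (-1 : ℤ) ^ (i : ℕ) • res P (U.inter_le_face s i) (c (s ∘ i.succAbove))
  map_zero' := by
    funext s
    simp
  map_add' a b := by
    funext s
    simp [Finset.sum_add_distrib]

/-- Čech cocycles. -/
def cocycles (n : ℕ) : AddSubgroup (Cochain P U n) := (d P U n).ker

/-- Čech coboundaries. -/
def coboundaries : (n : ℕ) → AddSubgroup (Cochain P U n)
  | 0 => ⊥
  | n + 1 => (d P U n).range

/-- Čech cohomology of the cover `U`: cocycles modulo coboundaries. -/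
abbrev CoverH (n : ℕ) : Type u :=
  cocycles P U n ⧸ (coboundaries P U n).addSubgroupOf (cocycles P U n)

variable {U}

/-- Restriction of cochains to a refinement. -/
def refine {V : PointCover X} (h : U ≤ V) (n : ℕ) : Cochain P U n →+ Cochain P V n where
  toFun c s := res P (PointCover.inter_mono h s) (c s)
  map_zero' := by
    funext s
    simp
  map_add' a b := by
    funext s
    simp

theorem d_refine {V : PointCover X} (h : U ≤ V) (n : ℕ) (c : Cochain P U n) :
    d P V n (refine P h n c) = refine P h (n + 1) (d P U n c) := by
  funext s
  simp only [d, refine, AddMonoidHom.coe_mk, ZeroHom.coe_mk, map_sum, map_zsmul, res_res]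

theorem refine_mem_cocycles {V : PointCover X} (h : U ≤ V) {n : ℕ} {c : Cochain P U n}
    (hc : c ∈ cocycles P U n) : refine P h n c ∈ cocycles P V n := by
  have hc' : d P U n c = 0 := hc
  change d P V n (refine P h n c) = 0
  rw [d_refine, hc', map_zero]

theorem refine_mem_coboundaries {V : PointCover X} (h : U ≤ V) {n : ℕ} {c : Cochain P U n}
    (hc : c ∈ coboundaries P U n) : refine P h n c ∈ coboundaries P V n := by
  cases n with
  | zero =>
    have hc' : c = 0 := hc
    rw [hc', map_zero]
    exact zero_mem _
  | succ n =>
    obtain ⟨b, rfl⟩ := hc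
    exact ⟨refine P h n b, d_refine P h n b⟩

/-- Restriction of cocycles to a refinement. -/
def refineCocycles {V : PointCover X} (h : U ≤ V) (n : ℕ) : cocycles P U n →+ cocycles P V n :=
  ((refine P h n).comp (cocycles P U n).subtype).codRestrict _
    fun c => refine_mem_cocycles P h c.2

/-- The map induced by a refinement on the cohomology of covers. -/
def refineH (n : ℕ) (U V : PointCover X) (h : U ≤ V) : CoverH P U n →+ CoverH P V n :=
  QuotientAddGroup.map _ _ (refineCocycles P h n)
    fun _ hc => refine_mem_coboundaries P h hc

instance (n : ℕ) : DirectedSystem (CoverH P · n) (fun U V h => refineH P n U V h) where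
  map_self := by
    intro U c
    induction c using QuotientAddGroup.induction_on with
    | H c =>
      refine congrArg _ (Subtype.ext (funext fun s => ?_))
      exact res_self P _ _
  map_map := by
    intro U V W h k c
    induction c using QuotientAddGroup.induction_on with
    | H c =>
      refine congrArg _ (Subtype.ext (funext fun s => ?_))
      exact res_res P _ _ _

/-- Čech cohomology `Ȟⁿ(X; P)`, the direct limit over all open covers. -/
abbrev CechH (n : ℕ) : Type u :=
  AddCommGroup.DirectLimit (CoverH P · n) (refineH P n)

/-- The Čech cohomology class of a cocycle of a cover. -/
def cechClass (U : PointCover X) (n : ℕ) : cocycles P U n →+ CechH P n :=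
  (AddCommGroup.DirectLimit.of (CoverH P · n) (refineH P n) U).comp
    (QuotientAddGroup.mk' _)

variable {P} {A B C : (Opens X)ᵒᵖ ⥤ AddCommGrpCat.{u}}

/-- The map on cochains induced by a morphism of presheaves. -/
def mapCochain (f : A ⟶ B) (U : PointCover X) (n : ℕ) : Cochain A U n →+ Cochain B U n where
  toFun c s := (f.app (op (U.inter s))).hom (c s)
  map_zero' := by
    funext s
    simp
  map_add' a b := by
    funext s
    simp

/-- The graph of the connecting homomorphism `δ : Ȟⁿ(X; C) → Ȟⁿ⁺¹(X; A)` of a short exact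
sequence `0 ⟶ A ⟶ B ⟶ C ⟶ 0`: on some cover, lift a cocycle `γ` representing `c` to a cochain `b`
of `B`; the cocycle `α` of `A` that maps to `d b` represents `δ c`. -/
def IsConnecting (f : A ⟶ B) (g : B ⟶ C) (n : ℕ) (c : CechH C n) (a : CechH A (n + 1)) : Prop :=
  ∃ (U : PointCover X) (γ : cocycles C U n) (b : Cochain B U n) (α : cocycles A U (n + 1)),
    cechClass C U n γ = c ∧ mapCochain g U n b = γ ∧
    mapCochain f U (n + 1) α = d B U n b ∧ cechClass A U (n + 1) α = a

end Cech

/-! ### The exponential sequence of entire families -/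

section Exponential

variable {X : Type u} [TopologicalSpace X]

/-- The ring `𝒪(U)` of continuous functions `U × ℂ → ℂ` that are entire in the second variable. -/
def entireFamilies (U : Opens X) : Subring (U × ℂ → ℂ) where
  carrier := {h | Continuous h ∧ ∀ x, Differentiable ℂ fun z => h (x, z)}
  mul_mem' ha hb := ⟨ha.1.mul hb.1, fun x => (ha.2 x).mul (hb.2 x)⟩
  one_mem' := ⟨continuous_const, fun _ => differentiable_const _⟩
  add_mem' ha hb := ⟨ha.1.add hb.1, fun x => (ha.2 x).add (hb.2 x)⟩
  zero_mem' := ⟨continuous_const, fun _ => differentiable_const _⟩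
  neg_mem' ha := ⟨ha.1.neg, fun x => (ha.2 x).neg⟩

/-- The units of `𝒪(U)` are its nowhere vanishing elements. -/
theorem isUnit_iff_ne_zero {U : Opens X} (h : entireFamilies U) :
    IsUnit h ↔ ∀ p, h.1 p ≠ 0 := by
  constructor
  · rintro ⟨v, rfl⟩ p hp
    have e : (v : entireFamilies U).1 p * ((v⁻¹ : (entireFamilies U)ˣ) : entireFamilies U).1 p = 1 :=
      congrFun (congrArg Subtype.val v.mul_inv) p
    rw [hp, zero_mul] at e
    exact zero_ne_one e
  · intro hp
    refine IsUnit.of_mul_eq_one ⟨fun p => (h.1 p)⁻¹, h.2.1.inv₀ hp, fun x => ?_⟩ ?_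
    · exact (h.2.2 x).fun_inv fun z => hp (x, z)
    · exact Subtype.ext (funext fun p => mul_inv_cancel₀ (hp p))

/-- Restriction of entire families to a smaller open set. -/
def restrict {U V : Opens X} (h : V ≤ U) : entireFamilies U →+* entireFamilies V where
  toFun f := ⟨fun p => f.1 (Set.inclusion h p.1, p.2),
    f.2.1.comp (((continuous_inclusion h).comp continuous_fst).prodMk continuous_snd),
    fun x => f.2.2 (Set.inclusion h x)⟩
  map_one' := rfl
  map_mul' _ _ := rfl
  map_zero' := rfl
  map_add' _ _ := rfl

/-- The exponential of an entire family, as a nowhere vanishing entire family. -/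
def expUnit {U : Opens X} (f : entireFamilies U) : (entireFamilies U)ˣ where
  val := ⟨fun p => Complex.exp (f.1 p), Complex.continuous_exp.comp f.2.1,
    fun x => (f.2.2 x).cexp⟩
  inv := ⟨fun p => Complex.exp (-f.1 p), Complex.continuous_exp.comp f.2.1.neg,
    fun x => (f.2.2 x).neg.cexp⟩
  val_inv := Subtype.ext (funext fun p => by simp [← Complex.exp_add])
  inv_val := Subtype.ext (funext fun p => by simp [← Complex.exp_add])

variable (X)

/-- The constant sheaf `ℤ`: locally constant integer-valued functions. -/
def sheafZ : (Opens X)ᵒᵖ ⥤ AddCommGrpCat.{u} where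
  obj U := AddCommGrpCat.of (LocallyConstant U.unop ℤ)
  map i := AddCommGrpCat.ofHom
    { toFun := fun f => f.comap ⟨Set.inclusion i.unop.le, continuous_inclusion i.unop.le⟩
      map_zero' := rfl
      map_add' := fun _ _ => rfl }

/-- The sheaf `𝒪`, under addition. -/
def sheafO : (Opens X)ᵒᵖ ⥤ AddCommGrpCat.{u} where
  obj U := AddCommGrpCat.of (entireFamilies U.unop)
  map i := AddCommGrpCat.ofHom (restrict i.unop.le).toAddMonoidHom

/-- The sheaf `𝒪ˣ` of nowhere vanishing sections of `𝒪`; its multiplication is written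
additively. -/
def sheafOUnits : (Opens X)ᵒᵖ ⥤ AddCommGrpCat.{u} where
  obj U := AddCommGrpCat.of (Additive (entireFamilies U.unop)ˣ)
  map i := AddCommGrpCat.ofHom
    (MonoidHom.toAdditive (Units.map (restrict i.unop.le).toMonoidHom))

/-- The inclusion `ℤ ≅ 2πiℤ ⟶ 𝒪`. -/
def twoPiI : sheafZ X ⟶ sheafO X where
  app U := AddCommGrpCat.ofHom
    { toFun := fun n => ⟨fun p => 2 * Real.pi * Complex.I * (n p.1 : ℂ),
        continuous_const.mul
          ((continuous_of_discreteTopology (f := fun k : ℤ => (k : ℂ))).comp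
            (n.continuous.comp continuous_fst)),
        fun x => differentiable_const (2 * Real.pi * Complex.I * (n x : ℂ))⟩
      map_zero' := Subtype.ext (funext fun p => by simp)
      map_add' := fun a b => Subtype.ext (funext fun p => by simp [mul_add]) }

/-- The exponential map `exp : 𝒪 ⟶ 𝒪ˣ`. -/
def expMap : sheafO X ⟶ sheafOUnits X where
  app U := AddCommGrpCat.ofHom
    { toFun := fun f => Additive.ofMul (expUnit f)
      map_zero' := congrArg Additive.ofMul
        (Units.ext (Subtype.ext (funext fun _ => Complex.exp_zero)))
      map_add' := fun a b => congrArg Additive.ofMul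
        (Units.ext (Subtype.ext (funext fun p => Complex.exp_add (a.1 p) (b.1 p)))) }

/-- `H²(X; ℤ)`. -/
abbrev H2Z : Type u := CechH (sheafZ X) 2

end Exponential

/-! ### Embedded coverings, Weierstrass families and the obstruction class -/

section Coverings

variable {X : Type u} [TopologicalSpace X]

/-- `E ⊆ X × ℂ` is a countably infinite-sheeted covering of `X` under the first projection. -/
def IsCountableCovering (E : Set (X × ℂ)) : Prop :=
  IsCoveringMap (fun e : E => e.1.1) ∧
    ∀ x, {z | (x, z) ∈ E}.Countable ∧ {z | (x, z) ∈ E}.Infinite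

/-- A closed embedded countable covering of `X`. -/
def IsClosedEmbeddedCovering (E : Set (X × ℂ)) : Prop :=
  IsClosed E ∧ IsCountableCovering E

/-- The zero locus `Z(F)`. -/
def zeroLocus (F : X × ℂ → ℂ) : Set (X × ℂ) := {p | F p = 0}

/-- A Weierstrass entire family. -/
structure IsWeierstrassFamily (F : X × ℂ → ℂ) : Prop where
  continuous : Continuous F
  entire : ∀ x, Differentiable ℂ fun z => F (x, z)
  covering : IsCountableCovering (zeroLocus F)

/-- Every `F (x, ·)` has only simple zeros. -/
def HasSimpleZeros (F : X × ℂ → ℂ) : Prop :=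
  ∀ x z, F (x, z) = 0 → deriv (fun w => F (x, w)) z ≠ 0

/-- `E` is the zero locus of a Weierstrass entire family, each point counted once. -/
def IsRealizable (E : Set (X × ℂ)) : Prop :=
  ∃ F : X × ℂ → ℂ, IsWeierstrassFamily F ∧ HasSimpleZeros F ∧ zeroLocus F = E

/-- `F ∈ 𝒪(U)` vanishes exactly on `E` over `U`, with simple zeros. -/
def IsLocalRealization (E : Set (X × ℂ)) (U : Opens X) (F : entireFamilies U) : Prop :=
  ∀ (x : U) (z : ℂ), (F.1 (x, z) = 0 ↔ ((x : X), z) ∈ E) ∧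
    (F.1 (x, z) = 0 → deriv (fun w => F.1 (x, w)) z ≠ 0)

/-- The Weierstrass elementary factor `(1 - w) exp (w + w ^ 2 / 2 + ⋯ + w ^ p / p)`. -/
def elementaryFactor (p : ℕ) (w : ℂ) : ℂ :=
  (1 - w) * Complex.exp (∑ k ∈ Finset.Icc 1 p, w ^ k / k)

/-- `F ∈ 𝒪(U)` is a Weierstrass product for `E` over `U`: there `E` is the disjoint union of the
graphs of continuous functions `s₁, s₂, …` (here indexed from `0`) which all avoid the constant
`c`, and `F (x, z) = ∏ₙ 𝓔ₙ ((z - c) / (sₙ x - c))`. -/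
def IsLocalWeierstrassProduct (E : Set (X × ℂ)) (U : Opens X) (F : entireFamilies U) : Prop :=
  ∃ (c : ℂ) (s : ℕ → U → ℂ), (∀ n, Continuous (s n)) ∧
    (∀ x, Function.Injective fun n => s n x) ∧
    (∀ (x : U) (z : ℂ), ((x : X), z) ∈ E ↔ ∃ n, s n x = z) ∧
    (∀ n x, s n x ≠ c) ∧
    ∀ (x : U) (z : ℂ),
      HasProd (fun n => elementaryFactor (n + 1) ((z - c) / (s n x - c))) (F.1 (x, z))

/-- The cocycle `h` of `𝒪ˣ` consists of the ratios `F_x / F_y` of the local sections `F_x`. -/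
def IsRatioCocycle (U : PointCover X) (F : ∀ x, entireFamilies (U.set x))
    (h : cocycles (sheafOUnits X) U 1) : Prop :=
  ∀ s : Fin 2 → X, restrict (U.inter_le s 0) (F (s 0)) =
    ((Additive.toMul (h.1 s : Additive (entireFamilies (U.inter s))ˣ) :
      (entireFamilies (U.inter s))ˣ) : entireFamilies (U.inter s)) *
      restrict (U.inter_le s 1) (F (s 1))

/-- `a = δ [F_x / F_y]`, for the connecting homomorphism `δ : H¹(X; 𝒪ˣ) → H²(X; ℤ)` of the
exponential sequence. -/
def IsRatioClass (U : PointCover X) (F : ∀ x, entireFamilies (U.set x)) (a : H2Z X) : Prop :=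
  ∃ h : cocycles (sheafOUnits X) U 1, IsRatioCocycle U F h ∧
    IsConnecting (twoPiI X) (expMap X) 1 (cechClass (sheafOUnits X) U 1 h) a

/-- `a` is the class obtained from some cover with local Weierstrass products for `E`. -/
def IsObstructionClass (E : Set (X × ℂ)) (a : H2Z X) : Prop :=
  ∃ (U : PointCover X) (F : ∀ x, entireFamilies (U.set x)),
    (∀ x, IsLocalWeierstrassProduct E (U.set x) (F x)) ∧ IsRatioClass U F a

/-- The obstruction class `c₁(E) ∈ H²(X; ℤ)`: the class obtained from any choice of local
Weierstrass products. -/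
def c1 (E : Set (X × ℂ)) : H2Z X := Classical.epsilon (IsObstructionClass E)

end Coverings

end WeierstrassCovering

end

/-!
Two local realizations of `E` over the same open set differ by a unit of `𝒪`, so the ratios of a
family of local realizations form a cocycle of `𝒪ˣ`, and its class does not depend on the family;
`E` is realizable exactly when this class is trivial. A partition of unity gives `H¹(X; 𝒪) = 0`, so
the connecting homomorphism `H¹(X; 𝒪ˣ) → H²(X; ℤ)` of the exponential sequence is injective.
Local realizations exist because `E` is closed: its sheets over a small open set `U` then leave
every compact subset of `ℂ` locally uniformly on `U`, which is what makes the Weierstrass product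
over the sheets converge to an element of `𝒪(U)`.
-/

noncomputable section

open CategoryTheory TopologicalSpace Opposite Filter Topology

universe u

namespace WeierstrassCovering

/-! ### Čech cochains -/

section Cech

variable {X : Type u} [TopologicalSpace X] {P : (Opens X)ᵒᵖ ⥤ AddCommGrpCat.{u}}
  {U : PointCover X}

theorem PointCover.mem_inter {n : ℕ} {s : Fin (n + 1) → X} {x : X} :
    x ∈ U.inter s ↔ ∀ i, x ∈ U.set (s i) := by
  simp only [← SetLike.mem_coe, PointCover.inter, Opens.coe_iInf, Set.mem_iInter]

theorem PointCover.le_inter_pair {V : Opens X} {x y : X} (hx : V ≤ U.set x) (hy : V ≤ U.set y) :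
    V ≤ U.inter ![x, y] :=
  le_iInf (Fin.forall_fin_two.2 ⟨hx, hy⟩)

theorem PointCover.set_le_inter_const (U : PointCover X) (x : X) :
    U.set x ≤ U.inter (fun _ : Fin 1 => x) :=
  le_iInf fun _ => le_rfl

theorem res_cochain_congr {n : ℕ} (c : Cochain P U n) {s t : Fin (n + 1) → X} (e : s = t)
    {V : Opens X} (hs : V ≤ U.inter s) (ht : V ≤ U.inter t) :
    res P hs (c s) = res P ht (c t) := by
  subst e
  rfl

theorem d_apply (n : ℕ) (c : Cochain P U n) (s : Fin (n + 2) → X) :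
    d P U n c s =
      ∑ i : Fin (n + 2), (-1 : ℤ) ^ (i : ℕ) • res P (U.inter_le_face s i) (c (s ∘ i.succAbove)) :=
  rfl

theorem d_d (n : ℕ) (c : Cochain P U n) : d P U (n + 1) (d P U n c) = 0 := by
  funext s
  simp only [d_apply, map_sum, map_zsmul, res_res, Finset.smul_sum, smul_smul, ← pow_add,
    Pi.zero_apply]
  rw [← Fintype.sum_prod_type']
  -- The two ways of removing a given pair of indices from `s` contribute opposite terms.
  refine Finset.sum_involution (fun q _ => (q.1.succAbove q.2, q.2.predAbove q.1)) ?_ ?_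
    (fun _ _ => Finset.mem_univ _) ?_
  · rintro ⟨i, j⟩ -
    have same_face : (s ∘ (i.succAbove j).succAbove) ∘ (j.predAbove i).succAbove =
        (s ∘ i.succAbove) ∘ j.succAbove :=
      funext fun k => congrArg s (Fin.succAbove_succAbove_succAbove_predAbove i j k)
    dsimp only
    rw [res_cochain_congr c same_face _ (((U.inter_le_face s i).trans
      (U.inter_le_face (s ∘ i.succAbove) j))), Fin.neg_one_pow_succAbove_add_predAbove, neg_smul,
      add_neg_cancel]
  · rintro ⟨i, j⟩ - - h
    exact Fin.succAbove_ne i j (congrArg Prod.fst h)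
  · rintro ⟨i, j⟩ -
    exact Prod.ext (Fin.succAbove_succAbove_predAbove i j) (Fin.predAbove_predAbove_succAbove i j)

theorem d_zero_apply (c : Cochain P U 0) (s : Fin 2 → X) :
    d P U 0 c s =
      res P ((U.inter_le s 1).trans (U.set_le_inter_const _)) (c fun _ => s 1) -
      res P ((U.inter_le s 0).trans (U.set_le_inter_const _)) (c fun _ => s 0) := by
  have face_zero : s ∘ (0 : Fin 2).succAbove = fun _ => s 1 := by
    funext i; fin_cases i; rfl
  have face_one : s ∘ (1 : Fin 2).succAbove = fun _ => s 0 := by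
    funext i; fin_cases i; rfl
  rw [d_apply, Fin.sum_univ_two, sub_eq_add_neg]
  simp only [Fin.val_zero, Fin.val_one, pow_zero, pow_one, one_smul, neg_smul]
  exact congrArg₂ _ (res_cochain_congr c face_zero _ _)
    (congrArg _ (res_cochain_congr c face_one _ _))

theorem d_one_apply (c : Cochain P U 1) (s : Fin 3 → X) :
    d P U 1 c s =
      res P (PointCover.le_inter_pair (U.inter_le s 1) (U.inter_le s 2)) (c ![s 1, s 2]) -
      res P (PointCover.le_inter_pair (U.inter_le s 0) (U.inter_le s 2)) (c ![s 0, s 2]) +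
      res P (PointCover.le_inter_pair (U.inter_le s 0) (U.inter_le s 1)) (c ![s 0, s 1]) := by
  have face_zero : s ∘ (0 : Fin 3).succAbove = ![s 1, s 2] := by
    funext i; fin_cases i <;> rfl
  have face_one : s ∘ (1 : Fin 3).succAbove = ![s 0, s 2] := by
    funext i; fin_cases i <;> rfl
  have face_two : s ∘ (2 : Fin 3).succAbove = ![s 0, s 1] := by
    funext i; fin_cases i <;> rfl
  rw [d_apply, Fin.sum_univ_three, sub_eq_add_neg]
  simp only [Fin.val_zero, Fin.val_one, Fin.val_two, pow_zero, pow_one, even_two.neg_one_pow,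
    one_smul, neg_smul]
  exact congrArg₂ _ (congrArg₂ _ (res_cochain_congr c face_zero _ _)
    (congrArg _ (res_cochain_congr c face_one _ _))) (res_cochain_congr c face_two _ _)

theorem mem_cocycles_one {c : Cochain P U 1} :
    c ∈ cocycles P U 1 ↔ ∀ s : Fin 3 → X,
      res P (PointCover.le_inter_pair (U.inter_le s 0) (U.inter_le s 2)) (c ![s 0, s 2]) =
      res P (PointCover.le_inter_pair (U.inter_le s 0) (U.inter_le s 1)) (c ![s 0, s 1]) +
      res P (PointCover.le_inter_pair (U.inter_le s 1) (U.inter_le s 2)) (c ![s 1, s 2]) := by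
  refine AddMonoidHom.mem_ker.trans (funext_iff.trans (forall_congr' fun s => ?_))
  rw [d_one_apply, Pi.zero_apply, sub_add_eq_add_sub, sub_eq_zero, eq_comm,
    add_comm (res P _ (c ![s 1, s 2]))]

theorem res_add_res_of_mem_cocycles {c : Cochain P U 1} (hc : c ∈ cocycles P U 1) {V : Opens X}
    {x y z : X} (hx : V ≤ U.set x) (hy : V ≤ U.set y) (hz : V ≤ U.set z) :
    res P (PointCover.le_inter_pair hx hy) (c ![x, y]) +
      res P (PointCover.le_inter_pair hy hz) (c ![y, z]) =
      res P (PointCover.le_inter_pair hx hz) (c ![x, z]) := by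
  have hV : V ≤ U.inter ![x, y, z] := le_iInf fun i => by
    fin_cases i <;> assumption
  have relation := congrArg (res P hV) (mem_cocycles_one.1 hc ![x, y, z])
  rw [map_add, res_res, res_res, res_res] at relation
  exact relation.symm

/-- The `0`-cochain given by a section over each member of the cover. -/
def ofFamily (b : ∀ x, P.obj (op (U.set x))) : Cochain P U 0 :=
  fun s => res P (U.inter_le s 0) (b (s 0))

theorem d_ofFamily (b : ∀ x, P.obj (op (U.set x))) (s : Fin 2 → X) :
    d P U 0 (ofFamily b) s =
      res P (U.inter_le s 1) (b (s 1)) - res P (U.inter_le s 0) (b (s 0)) := by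
  simp only [d_zero_apply, ofFamily, res_res]

theorem mem_coboundaries_one {c : Cochain P U 1} :
    c ∈ coboundaries P U 1 ↔ ∃ b : ∀ x, P.obj (op (U.set x)), ∀ s,
      c s = res P (U.inter_le s 1) (b (s 1)) - res P (U.inter_le s 0) (b (s 0)) := by
  refine ⟨?_, fun ⟨b, hb⟩ => ⟨ofFamily b, funext fun s => (d_ofFamily b s).trans (hb s).symm⟩⟩
  rintro ⟨e, rfl⟩
  refine ⟨fun x => res P (U.set_le_inter_const x) (e fun _ => x), fun s => ?_⟩
  rw [d_zero_apply, res_res, res_res]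

theorem refine_refine {V W : PointCover X} (h : U ≤ V) (k : V ≤ W) {n : ℕ} (c : Cochain P U n) :
    refine P k n (refine P h n c) = refine P (h.trans k) n c :=
  funext fun _ => res_res P _ _ _

theorem cechClass_refine {V : PointCover X} (h : U ≤ V) {n : ℕ} (c : cocycles P U n) :
    cechClass P V n (refineCocycles P h n c) = cechClass P U n c :=
  AddCommGroup.DirectLimit.of_f (G := (CoverH P · n)) (f := refineH P n) h
    (QuotientAddGroup.mk' _ c)

theorem cechClass_eq_zero_of_mem {n : ℕ} {c : cocycles P U n}
    (hc : (c : Cochain P U n) ∈ coboundaries P U n) : cechClass P U n c = 0 := by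
  have : QuotientAddGroup.mk' ((coboundaries P U n).addSubgroupOf (cocycles P U n)) c = 0 :=
    (QuotientAddGroup.eq_zero_iff _).2 hc
  rw [cechClass, AddMonoidHom.comp_apply, this, map_zero]

theorem cechClass_eq_zero_iff {n : ℕ} {c : cocycles P U n} :
    cechClass P U n c = 0 ↔
      ∃ (V : PointCover X) (h : U ≤ V), refine P h n c ∈ coboundaries P V n := by
  refine ⟨fun hc => ?_, fun ⟨V, h, hV⟩ => ?_⟩
  · obtain ⟨V, h, hV⟩ := AddCommGroup.DirectLimit.of.zero_exact (G := (CoverH P · n))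
      (f := refineH P n) U _ hc
    exact ⟨V, h, (QuotientAddGroup.eq_zero_iff (refineCocycles P h n c)).1 hV⟩
  · rw [← cechClass_refine h]
    exact cechClass_eq_zero_of_mem hV

theorem cechClass_eq_cechClass_iff {U' : PointCover X} {n : ℕ} {c : cocycles P U n}
    {c' : cocycles P U' n} :
    cechClass P U n c = cechClass P U' n c' ↔
      ∃ (V : PointCover X) (h : U ≤ V) (h' : U' ≤ V),
        refine P h n c - refine P h' n c' ∈ coboundaries P V n := by
  refine ⟨fun hc => ?_, fun ⟨V, h, h', hV⟩ => ?_⟩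
  · obtain ⟨W, k, k'⟩ := exists_ge_ge U U'
    have class_sub : cechClass P W n (refineCocycles P k n c - refineCocycles P k' n c') = 0 := by
      rw [map_sub, cechClass_refine, cechClass_refine, hc, sub_self]
    obtain ⟨V, h, hV⟩ := cechClass_eq_zero_iff.1 class_sub
    refine ⟨V, k.trans h, k'.trans h, ?_⟩
    rw [← refine_refine k h, ← refine_refine k' h, ← map_sub]
    exact hV
  · rw [← cechClass_refine h c, ← cechClass_refine h' c', ← sub_eq_zero,
      ← map_sub (cechClass P V n)]
    exact cechClass_eq_zero_of_mem hV

end Cech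

/-! ### The connecting homomorphism -/

section Connecting

variable {X : Type u} [TopologicalSpace X] {A B C : (Opens X)ᵒᵖ ⥤ AddCommGrpCat.{u}}

theorem app_res (g : B ⟶ C) {U V : Opens X} (h : V ≤ U) (b : B.obj (op U)) :
    (g.app (op V)).hom (res B h b) = res C h ((g.app (op U)).hom b) :=
  ConcreteCategory.congr_hom (g.naturality (homOfLE h).op) b

theorem mapCochain_d (g : B ⟶ C) (U : PointCover X) (n : ℕ) (b : Cochain B U n) :
    mapCochain g U (n + 1) (d B U n b) = d C U n (mapCochain g U n b) := by
  funext s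
  simp only [d, mapCochain, AddMonoidHom.coe_mk, ZeroHom.coe_mk, map_sum, map_zsmul, app_res]

theorem mapCochain_refine (g : B ⟶ C) {U V : PointCover X} (h : U ≤ V) (n : ℕ)
    (b : Cochain B U n) :
    mapCochain g V n (refine B h n b) = refine C h n (mapCochain g U n b) :=
  funext fun _ => app_res g _ _

theorem mapCochain_injective {f : A ⟶ B}
    (hf : ∀ U : Opens X, Function.Injective (f.app (op U)).hom) (U : PointCover X) (n : ℕ) :
    Function.Injective (mapCochain f U n) :=
  fun _ _ h => funext fun s => hf _ (congrFun h s)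

theorem exact_mapCochain {f : A ⟶ B} {g : B ⟶ C}
    (hfg : ∀ U : Opens X, Function.Exact (f.app (op U)).hom (g.app (op U)).hom)
    (U : PointCover X) (n : ℕ) : Function.Exact (mapCochain f U n) (mapCochain g U n) := by
  refine fun b => ⟨fun hb => ?_, ?_⟩
  · choose a ha using fun s => (hfg (U.inter s) (b s)).1 (congrFun hb s)
    exact ⟨a, funext ha⟩
  · rintro ⟨a, rfl⟩
    exact funext fun s => (hfg (U.inter s)).apply_apply_eq_zero (a s)

theorem isLocallySurjective_iff {g : B ⟶ C} :
    Presheaf.IsLocallySurjective (Opens.grothendieckTopology X) g ↔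
      ∀ (U : Opens X) (c : C.obj (op U)), ∀ x ∈ U,
        ∃ (V : Opens X) (h : V ≤ U), x ∈ V ∧ res C h c ∈ (g.app (op V)).hom.range := by
  refine ⟨fun hg U c x hx => ?_, fun hg => ⟨fun {U} c x hx => ?_⟩⟩
  · obtain ⟨V, i, ⟨b, hb⟩, hxV⟩ :=
      Presheaf.imageSieve_mem (Opens.grothendieckTopology X) g c x hx
    exact ⟨V, i.le, hxV, b, hb⟩
  · obtain ⟨V, h, hxV, b, hb⟩ := hg U c x hx
    exact ⟨V, homOfLE h, ⟨b, hb⟩, hxV⟩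

theorem exists_mapCochain_zero_eq_refine {g : B ⟶ C}
    [Presheaf.IsLocallySurjective (Opens.grothendieckTopology X) g] {U : PointCover X}
    (c : Cochain C U 0) :
    ∃ (V : PointCover X) (h : U ≤ V) (b : Cochain B V 0),
      mapCochain g V 0 b = refine C h 0 c := by
  choose V h hV b hb using fun x => isLocallySurjective_iff.1 ‹_› (U.set x)
    (res C (U.set_le_inter_const x) (c fun _ => x)) x (U.mem x)
  refine ⟨⟨V, hV⟩, h, ofFamily (U := ⟨V, hV⟩) b, funext fun s => ?_⟩
  change (g.app _).hom (res B _ (b (s 0))) = res C _ (c s)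
  rw [app_res, hb, res_res, res_res]
  have const_eta : (fun _ => s 0) = s := funext (Fin.forall_fin_one.2 rfl)
  exact res_cochain_congr c const_eta _ _

/-- The component `c_{xy}` of the `1`-cochain `c` is in the image of `g` over `V ⊆ U_x ∩ U_y`. -/
def LiftsOn (g : B ⟶ C) {U : PointCover X} (c : Cochain C U 1) (x y : X) (V : Opens X) : Prop :=
  ∃ h : V ≤ U.inter ![x, y], res C h (c ![x, y]) ∈ (g.app (op V)).hom.range

namespace LiftsOn

variable {g : B ⟶ C} {U : PointCover X} {c : Cochain C U 1} {x y z : X} {V W : Opens X}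

theorem le_left (h : LiftsOn g c x y V) : V ≤ U.set x := h.1.trans (U.inter_le _ 0)

theorem le_right (h : LiftsOn g c x y V) : V ≤ U.set y := h.1.trans (U.inter_le _ 1)

theorem mono (h : LiftsOn g c x y V) (hW : W ≤ V) : LiftsOn g c x y W := by
  obtain ⟨hV, b, hb⟩ := h
  exact ⟨hW.trans hV, res B hW b, by rw [app_res, hb, res_res]⟩

theorem trans (hc : c ∈ cocycles C U 1) (hxy : LiftsOn g c x y V) (hyz : LiftsOn g c y z V) :
    LiftsOn g c x z V := by
  refine ⟨PointCover.le_inter_pair hxy.le_left hyz.le_right, ?_⟩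
  rw [← res_add_res_of_mem_cocycles hc hxy.le_left hxy.le_right hyz.le_right]
  exact add_mem hxy.2 hyz.2

theorem left_cancel (hc : c ∈ cocycles C U 1) (hxy : LiftsOn g c x y V)
    (hxz : LiftsOn g c x z V) : LiftsOn g c y z V := by
  refine ⟨PointCover.le_inter_pair hxy.le_right hxz.le_right, ?_⟩
  rw [eq_sub_of_add_eq'
    (res_add_res_of_mem_cocycles hc hxy.le_left hxy.le_right hxz.le_right)]
  exact sub_mem hxz.2 hxy.2

end LiftsOn

variable {g : B ⟶ C} [Presheaf.IsLocallySurjective (Opens.grothendieckTopology X) g]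

theorem eventually_liftsOn {U : PointCover X} (c : Cochain C U 1) {x y z : X} (hx : z ∈ U.set x)
    (hy : z ∈ U.set y) :
    ∀ᶠ t in (𝓝 z).smallSets, ∀ V : Opens X, (V : Set X) ⊆ t → LiftsOn g c x y V := by
  obtain ⟨V, h, hz, hV⟩ := isLocallySurjective_iff.1 ‹_› (U.inter ![x, y]) (c ![x, y]) z
    (PointCover.mem_inter.2 (Fin.forall_fin_two.2 ⟨hx, hy⟩))
  have lift : LiftsOn g c x y V := ⟨h, hV⟩
  exact eventually_smallSets.2 ⟨V, V.2.mem_nhds hz, fun t ht W hW => lift.mono (hW.trans ht)⟩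

theorem exists_mem_liftsOn_of_locallyFinite {U : PointCover X} (c : Cochain C U 1) {w : X → Set X}
    (hw : LocallyFinite w) (w_open : ∀ y, IsOpen (w y)) (hwU : ∀ y, closure (w y) ⊆ U.set y)
    {x i : X} (hi : x ∈ w i) :
    ∃ V : Opens X, x ∈ V ∧ V ≤ U.set x ∧ (V : Set X) ⊆ w i ∧ LiftsOn g c i x V ∧
      ∀ j, ((V : Set X) ∩ w j).Nonempty → LiftsOn g c i j V := by
  have hxi : x ∈ U.set i := hwU i (subset_closure hi)
  have meets_only : ∀ᶠ t in (𝓝 x).smallSets, ∀ j, (t ∩ w j).Nonempty → x ∈ closure (w j) := by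
    refine (eventually_smallSets_subset.2 (hw.closure.iInter_compl_mem_nhds
      (fun _ => isClosed_closure) x)).mono fun t ht j ⟨y, hyt, hyj⟩ => ?_
    by_contra hxj
    exact Set.mem_iInter₂.1 (ht hyt) j hxj (subset_closure hyj)
  have lifts_all : ∀ᶠ t in (𝓝 x).smallSets, ∀ j ∈ {j | x ∈ closure (w j)},
      ∀ V : Opens X, (V : Set X) ⊆ t → LiftsOn g c i j V :=
    (eventually_all_finite (hw.closure.point_finite x)).2
      fun j hj => eventually_liftsOn c hxi (hwU j hj)
  obtain ⟨t, ht, good⟩ := eventually_smallSets.1 <|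
    (eventually_smallSets_subset.2 ((U.set x).2.mem_nhds (U.mem x))).and <|
    (eventually_smallSets_subset.2 ((w_open i).mem_nhds hi)).and <|
    (eventually_liftsOn (g := g) c hxi (U.mem x)).and (meets_only.and lifts_all)
  obtain ⟨O, hOt, hO, hxO⟩ := mem_nhds_iff.1 ht
  obtain ⟨hOU, hOw, hOx, hOj, hOl⟩ := good O hOt
  exact ⟨⟨O, hO⟩, hxO, hOU, hOw, hOx ⟨O, hO⟩ subset_rfl,
    fun j hj => hOl j (hOj j hj) ⟨O, hO⟩ subset_rfl⟩

theorem PointCover.exists_locallyFinite_shrinking [T2Space X] [ParacompactSpace X]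
    (U : PointCover X) :
    ∃ w : X → Set X, LocallyFinite w ∧ (∀ y, IsOpen (w y)) ∧ ⋃ y, w y = Set.univ ∧
      ∀ y, closure (w y) ⊆ U.set y := by
  obtain ⟨v, v_open, v_cover, hv, hvU⟩ := precise_refinement (fun x => (U.set x : Set X))
    (fun x => (U.set x).2) (Set.iUnion_eq_univ_iff.2 fun x => ⟨x, U.mem x⟩)
  obtain ⟨w, w_cover, w_open, hwv⟩ := exists_iUnion_eq_closure_subset v_open hv.point_finite v_cover
  exact ⟨w, hv.subset fun i => subset_closure.trans (hwv i), w_open, w_cover,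
    fun i => (hwv i).trans (hvU i)⟩

variable [T2Space X] [ParacompactSpace X] [Subsingleton (C.obj (op ⊥))]

/-- A locally surjective map need not lift `γ_{xy}` over all of `V_x ∩ V_y`, however small the
cover `V`. It does if `x ↦ τ x` comes from a locally finite cover: near `x` there are only finitely
many sections `γ_{τ x, j}` to lift, and `γ_{xy} = γ_{τ x, τ y} + γ_{τ y, y} - γ_{τ x, x}`. -/
theorem exists_mapCochain_one_eq_refine {U : PointCover X} (γ : cocycles C U 1) :
    ∃ (V : PointCover X) (h : U ≤ V) (b : Cochain B V 1),
      mapCochain g V 1 b = refine C h 1 γ := by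
  obtain ⟨w, hw, w_open, w_cover, hwU⟩ := U.exists_locallyFinite_shrinking
  choose τ hτ using Set.iUnion_eq_univ_iff.1 w_cover
  choose V hxV hVU hVw lift_self lift_meet using fun x =>
    exists_mem_liftsOn_of_locallyFinite (g := g) γ.1 hw w_open hwU (hτ x)
  let V' : PointCover X := ⟨V, hxV⟩
  suffices ∀ s : Fin 2 → X, refine C (U := U) (V := V') hVU 1 γ s ∈ (g.app _).hom.range by
    choose b hb using this
    exact ⟨V', hVU, b, funext hb⟩
  intro s
  by_cases hs : V'.inter s = ⊥
  · have : Subsingleton (C.obj (op (V'.inter s))) := by rwa [hs]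
    exact ⟨0, Subsingleton.elim _ _⟩
  obtain ⟨y, hy⟩ := (Opens.ne_bot_iff_nonempty _).1 hs
  have h0 : V'.inter s ≤ V (s 0) := V'.inter_le s 0
  have h1 : V'.inter s ≤ V (s 1) := V'.inter_le s 1
  have lift_τ : LiftsOn g γ.1 (τ (s 0)) (τ (s 1)) (V'.inter s) :=
    (lift_meet (s 0) (τ (s 1)) ⟨y, h0 hy, hVw _ (h1 hy)⟩).mono h0
  obtain ⟨h, hmem⟩ := ((lift_self (s 0)).mono h0).left_cancel γ.2
    (lift_τ.trans γ.2 ((lift_self (s 1)).mono h1))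
  have pair_eta : ![s 0, s 1] = s := funext (Fin.forall_fin_two.2 ⟨rfl, rfl⟩)
  rwa [res_cochain_congr γ.1 pair_eta h (PointCover.inter_mono (U := U) (V := V') hVU s)] at hmem

end Connecting

section IsConnecting

variable {X : Type u} [TopologicalSpace X] {A B C : (Opens X)ᵒᵖ ⥤ AddCommGrpCat.{u}}
  {f : A ⟶ B} {g : B ⟶ C}

theorem isConnecting_zero (f : A ⟶ B) (g : B ⟶ C) (n : ℕ) : IsConnecting f g n 0 0 :=
  ⟨Classical.arbitrary _, 0, 0, 0, map_zero _, map_zero _, by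
    rw [map_zero, AddSubgroup.coe_zero, map_zero], map_zero _⟩

theorem IsConnecting.eq_zero {n : ℕ}
    (hB : ∀ V, cocycles B V (n + 1) ≤ coboundaries B V (n + 1))
    (hfg : ∀ U : Opens X, Function.Exact (f.app (op U)).hom (g.app (op U)).hom)
    {c : CechH C (n + 1)} (h : IsConnecting f g (n + 1) c 0) : c = 0 := by
  obtain ⟨U, γ, b, α, rfl, hb, hα, hα0⟩ := h
  obtain ⟨V, k, β, hβ⟩ := cechClass_eq_zero_iff.1 hα0
  have corrected : refine B k (n + 1) b - mapCochain f V (n + 1) β ∈ cocycles B V (n + 1) := by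
    refine AddMonoidHom.mem_ker.2 ?_
    rw [map_sub, d_refine, ← mapCochain_d, hβ, mapCochain_refine, hα, sub_self]
  obtain ⟨e, he⟩ := hB V corrected
  refine cechClass_eq_zero_iff.2 ⟨V, k, mapCochain g V n e, ?_⟩
  rw [← mapCochain_d, he, map_sub, mapCochain_refine, hb,
    (exact_mapCochain hfg V (n + 1)).apply_apply_eq_zero, sub_zero]

variable [Presheaf.IsLocallySurjective (Opens.grothendieckTopology X) g]

theorem IsConnecting.unique
    (hf : ∀ U : Opens X, Function.Injective (f.app (op U)).hom)
    (hfg : ∀ U : Opens X, Function.Exact (f.app (op U)).hom (g.app (op U)).hom)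
    {c : CechH C 1} {a a' : CechH A 2} (h : IsConnecting f g 1 c a)
    (h' : IsConnecting f g 1 c a') : a = a' := by
  obtain ⟨U, γ, b, α, hγ, hb, hα, rfl⟩ := h
  obtain ⟨U', γ', b', α', hγ', hb', hα', rfl⟩ := h'
  obtain ⟨V, k, k', η, hη⟩ := cechClass_eq_cechClass_iff.1 (hγ.trans hγ'.symm)
  obtain ⟨W, l, e, he⟩ := exists_mapCochain_zero_eq_refine (g := g) η
  have corrected : mapCochain g W 1 (refine B (k.trans l) 1 b - refine B (k'.trans l) 1 b' -
      d B W 0 e) = 0 := by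
    rw [map_sub, map_sub, mapCochain_refine, mapCochain_refine, mapCochain_d, he, hb, hb',
      d_refine, hη, map_sub, refine_refine, refine_refine, sub_self]
  obtain ⟨β, hβ⟩ := (exact_mapCochain hfg W 1 _).1 corrected
  refine cechClass_eq_cechClass_iff.2
    ⟨W, k.trans l, k'.trans l, β, mapCochain_injective hf W 2 ?_⟩
  rw [mapCochain_d, hβ, map_sub, map_sub, d_d, sub_zero, map_sub, mapCochain_refine,
    mapCochain_refine, hα, hα', d_refine, d_refine]

theorem exists_isConnecting [T2Space X] [ParacompactSpace X] [Subsingleton (C.obj (op ⊥))]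
    (hf : ∀ U : Opens X, Function.Injective (f.app (op U)).hom)
    (hfg : ∀ U : Opens X, Function.Exact (f.app (op U)).hom (g.app (op U)).hom)
    {U : PointCover X} (γ : cocycles C U 1) :
    ∃ a, IsConnecting f g 1 (cechClass C U 1 γ) a := by
  obtain ⟨V, h, b, hb⟩ := exists_mapCochain_one_eq_refine (g := g) γ
  have image_zero : mapCochain g V 2 (d B V 1 b) = 0 := by
    rw [mapCochain_d, hb, d_refine, AddMonoidHom.mem_ker.1 γ.2, map_zero]
  obtain ⟨α, hα⟩ := (exact_mapCochain hfg V 2 _).1 image_zero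
  have hα_cocycle : α ∈ cocycles A V 2 := by
    refine mapCochain_injective hf V 3 ?_
    rw [mapCochain_d, hα, d_d, map_zero]
  exact ⟨_, V, refineCocycles C h 1 γ, b, ⟨α, hα_cocycle⟩, cechClass_refine h γ, hb, hα, rfl⟩

end IsConnecting

/-! ### Exactness of the exponential sequence -/

section Logarithm

theorem continuous_of_eq_intCast_mul_two_pi_I {T : Type*} [TopologicalSpace T] {b : T → ℂ}
    (hb : Continuous b) {n : T → ℤ} (hn : ∀ p, b p = n p * (2 * Real.pi * Complex.I)) :
    Continuous n := by
  have cast_eq : ((↑) : ℤ → ℝ) ∘ n = fun p => (b p / (2 * Real.pi * Complex.I)).re := by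
    funext p
    rw [hn p, mul_div_cancel_right₀ _ Complex.two_pi_I_ne_zero, Complex.intCast_re,
      Function.comp_apply]
  rw [Int.isClosedEmbedding_coe_real.isEmbedding.continuous_iff, cast_eq]
  exact Complex.continuous_re.comp (hb.div_const _)

theorem differentiable_of_exp_eq {b h : ℂ → ℂ} (hb : Continuous b) (hh : Differentiable ℂ h)
    (e : ∀ z, Complex.exp (b z) = h z) : Differentiable ℂ b := by
  intro z₀
  have im_small : ∀ᶠ z in 𝓝 z₀, |(b z - b z₀).im| < Real.pi :=
    (show Continuous fun z => |(b z - b z₀).im| by fun_prop).continuousAt.eventually_lt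
      continuousAt_const (by simp [Real.pi_pos])
  have eq_log : b =ᶠ[𝓝 z₀] fun z => b z₀ + Complex.log (h z / h z₀) := by
    filter_upwards [im_small] with z hz
    rw [← e z, ← e z₀, ← Complex.exp_sub, Complex.log_exp (abs_lt.1 hz).1 (abs_lt.1 hz).2.le,
      add_sub_cancel]
  refine (DifferentiableAt.const_add _ (((hh z₀).div_const _).clog ?_)).congr_of_eventuallyEq eq_log
  rw [← e z₀, div_self (Complex.exp_ne_zero _)]
  exact Complex.one_mem_slitPlane

theorem exists_continuousOn_log_nhds {T : Type*} [TopologicalSpace T] {h : T → ℂ}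
    (hh : Continuous h) {t : T} (ht : h t ≠ 0) :
    ∃ V : Opens T, t ∈ V ∧ ∃ l : T → ℂ, ContinuousOn l V ∧ ∀ x ∈ V, Complex.exp (l x) = h x := by
  refine ⟨⟨{x | h x / h t ∈ Complex.slitPlane},
    Complex.isOpen_slitPlane.preimage (hh.div_const _)⟩, ?_,
    fun x => Complex.log (h t) + Complex.log (h x / h t),
    continuousOn_const.add ((hh.div_const _).continuousOn.clog fun x hx => hx), fun x hx => ?_⟩
  · change h t / h t ∈ Complex.slitPlane
    rw [div_self ht]
    exact Complex.one_mem_slitPlane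
  · rw [Complex.exp_add, Complex.exp_log ht, Complex.exp_log (Complex.slitPlane_ne_zero hx),
      mul_div_cancel₀ _ ht]

/-- The logarithm is continued along the rays of `F`, by homotopy lifting for `exp : ℂ → ℂ ∖ 0`. -/
theorem exists_continuous_log_prod {T F : Type*} [TopologicalSpace T] [TopologicalSpace F]
    [AddCommGroup F] [Module ℝ F] [ContinuousSMul ℝ F] {k : T × F → ℂ} (hk : Continuous k)
    (hk0 : ∀ p, k p ≠ 0) {l : T → ℂ} (hl : Continuous l)
    (exp_l : ∀ x, Complex.exp (l x) = k (x, 0)) :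
    ∃ L : T × F → ℂ, Continuous L ∧ ∀ p, Complex.exp (L p) = k p := by
  let f : C(T × F, ℂ) := ⟨fun p => l p.1, hl.comp continuous_fst⟩
  let H : C(unitInterval × (T × F), {z : ℂ // z ≠ 0}) :=
    ⟨fun q => ⟨k (q.2.1, (q.1 : ℝ) • q.2.2), hk0 _⟩,
      Continuous.subtype_mk (hk.comp (by fun_prop)) _⟩
  have H_zero (p : T × F) : H (0, p) = ⟨Complex.exp (f p), Complex.exp_ne_zero _⟩ :=
    Subtype.ext <| by simp [H, f, exp_l]
  let L := Complex.isCoveringMap_exp.liftHomotopy H f H_zero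
  refine ⟨fun p => L (1, p), L.continuous.comp (by fun_prop), fun p => ?_⟩
  have lifts := congrArg Subtype.val
    (congrFun (Complex.isCoveringMap_exp.liftHomotopy_lifts H f H_zero) (1, p))
  exact lifts.trans (by simp [H])

end Logarithm

section ExponentialSequence

variable {X : Type u} [TopologicalSpace X]

theorem twoPiI_injective (U : Opens X) : Function.Injective ((twoPiI X).app (op U)).hom := by
  intro a b h
  change LocallyConstant U ℤ at a b
  refine LocallyConstant.ext fun x => ?_
  exact Int.cast_injective (mul_left_cancel₀ Complex.two_pi_I_ne_zero
    (congrFun (congrArg Subtype.val h) (x, 0)))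

theorem expUnit_eq_one_iff {U : Opens X} {b : entireFamilies U} :
    expUnit b = 1 ↔ ∀ p, Complex.exp (b.1 p) = 1 := by
  rw [Units.ext_iff, Subtype.ext_iff, funext_iff]
  rfl

theorem exact_twoPiI_expMap (U : Opens X) :
    Function.Exact ((twoPiI X).app (op U)).hom ((expMap X).app (op U)).hom := by
  refine fun (b : entireFamilies U) => (expUnit_eq_one_iff (b := b)).trans ⟨fun hb => ?_, ?_⟩
  · choose n hn using fun p => Complex.exp_eq_one_iff.1 (hb p)
    have hn_cont : Continuous n := continuous_of_eq_intCast_mul_two_pi_I b.2.1 hn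
    have n_eq (p : U × ℂ) : n (p.1, 0) = n p :=
      PreconnectedSpace.constant (Y := ℤ) (f := fun z : ℂ => n (p.1, z)) inferInstance
        (hn_cont.comp (by fun_prop))
    refine ⟨⟨fun x => n (x, 0), (IsLocallyConstant.iff_continuous _).2
      (hn_cont.comp (by fun_prop))⟩, Subtype.ext (funext fun p => ?_)⟩
    change 2 * Real.pi * Complex.I * (n (p.1, 0) : ℂ) = b.1 p
    rw [n_eq, hn p, mul_comm]
  · rintro ⟨a, rfl⟩ p
    change LocallyConstant U ℤ at a
    exact Complex.exp_eq_one_iff.2 ⟨a p.1, mul_comm _ _⟩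

theorem exists_expUnit_eq {U : Opens X} (h : (entireFamilies U)ˣ) {l : U → ℂ} (hl : Continuous l)
    (exp_l : ∀ x, Complex.exp (l x) = h.1.1 (x, 0)) : ∃ b, expUnit b = h := by
  obtain ⟨L, hL, exp_L⟩ :=
    exists_continuous_log_prod h.1.2.1 ((isUnit_iff_ne_zero h.1).1 h.isUnit) hl exp_l
  have L_entire (x : U) : Differentiable ℂ fun z => L (x, z) :=
    differentiable_of_exp_eq (hL.comp (by fun_prop)) (h.1.2.2 x) fun z => exp_L (x, z)
  exact ⟨⟨L, hL, L_entire⟩, Units.ext (Subtype.ext (funext exp_L))⟩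

instance isLocallySurjective_expMap :
    Presheaf.IsLocallySurjective (Opens.grothendieckTopology X) (expMap X) := by
  refine isLocallySurjective_iff.2 fun U (h : (entireFamilies U)ˣ) x₀ hx₀ => ?_
  have h_ne : ∀ p, h.1.1 p ≠ 0 := (isUnit_iff_ne_zero h.1).1 h.isUnit
  have h_zero_cont : Continuous fun x => h.1.1 (x, 0) := h.1.2.1.comp (by fun_prop)
  obtain ⟨T, hT, l, hl, exp_l⟩ := exists_continuousOn_log_nhds h_zero_cont (h_ne (⟨x₀, hx₀⟩, 0))
  let V : Opens X := ⟨Subtype.val '' (T : Set U), U.2.isOpenMap_subtype_val _ T.2⟩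
  have hVU : V ≤ U := Set.image_subset_iff.2 fun x _ => x.2
  have incl_mem : ∀ x : V, Set.inclusion hVU x ∈ T := by
    rintro ⟨_, x, hx, rfl⟩
    exact hx
  obtain ⟨b, hb⟩ := exists_expUnit_eq (Units.map (restrict hVU).toMonoidHom h)
    (hl.comp_continuous (continuous_inclusion hVU) incl_mem) fun x => exp_l _ (incl_mem x)
  exact ⟨V, hVU, ⟨⟨x₀, hx₀⟩, hT, rfl⟩, b, congrArg Additive.ofMul hb⟩

instance : Subsingleton ((sheafOUnits X).obj (op ⊥)) where
  allEq _ _ := congrArg Additive.ofMul (Units.ext (Subtype.ext (funext fun p => p.1.2.elim)))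

end ExponentialSequence

/-! ### Vanishing of `H¹(X; 𝒪)` -/

section PartitionOfUnity

variable {ι X Y : Type*} [TopologicalSpace X] [TopologicalSpace Y] {s : Set X}

/-- The pullback of a partition of unity along a continuous map. -/
def pullbackPartition (ρ : PartitionOfUnity ι X s) (φ : C(Y, X)) :
    PartitionOfUnity ι Y (φ ⁻¹' s) where
  toFun i := (ρ i).comp φ
  locallyFinite' := ρ.locallyFinite.preimage_continuous φ.continuous
  nonneg' i y := ρ.nonneg i (φ y)
  sum_eq_one' _ hy := ρ.sum_eq_one hy
  sum_le_one' y := ρ.sum_le_one (φ y)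

theorem tsupport_pullbackPartition_subset (ρ : PartitionOfUnity ι X s) (φ : C(Y, X)) (i : ι) :
    tsupport (pullbackPartition ρ φ i) ⊆ φ ⁻¹' tsupport (ρ i) :=
  tsupport_comp_subset_preimage (ρ i) φ.continuous

theorem finsum_smul_sub_finsum_smul {M : Type*} [AddCommGroup M] [Module ℝ M]
    (ρ : PartitionOfUnity ι X s) {f g : ι → M} {a : M} {x : X} (hx : x ∈ s)
    (h : ∀ i, x ∈ tsupport (ρ i) → f i - g i = a) :
    ∑ᶠ i, ρ i x • f i - ∑ᶠ i, ρ i x • g i = a := by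
  have finsum_eq (k : ι → M) : ∑ᶠ i, ρ i x • k i = ∑ i ∈ ρ.finsupport x, ρ i x • k i :=
    (ρ.sum_finsupport_smul_eq_finsum fun i _ => k i).symm
  rw [finsum_eq, finsum_eq, ← Finset.sum_sub_distrib]
  calc ∑ i ∈ ρ.finsupport x, (ρ i x • f i - ρ i x • g i)
      = ∑ i ∈ ρ.finsupport x, ρ i x • a := Finset.sum_congr rfl fun i hi => by
        rw [← smul_sub, h i (subset_tsupport _ ((ρ.mem_finsupport x).1 hi))]
    _ = a := by rw [← Finset.sum_smul, ρ.sum_finsupport hx, one_smul]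

end PartitionOfUnity

section Vanishing

variable {X : Type u} [TopologicalSpace X]

/-- An entire family over `U` as a function on `X × ℂ`, extended by zero outside `U × ℂ`. -/
def extendZero {U : Opens X} (h : entireFamilies U) (p : X × ℂ) : ℂ :=
  open Classical in if hp : p.1 ∈ U then h.1 (⟨p.1, hp⟩, p.2) else 0

theorem extendZero_of_mem {U : Opens X} (h : entireFamilies U) {p : X × ℂ} (hp : p.1 ∈ U) :
    extendZero h p = h.1 (⟨p.1, hp⟩, p.2) := dif_pos hp

theorem continuousOn_extendZero {U : Opens X} (h : entireFamilies U) :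
    ContinuousOn (extendZero h) {p | p.1 ∈ U} := by
  rw [continuousOn_iff_continuous_domRestrict]
  exact (h.2.1.comp (f := fun p : {p : X × ℂ | p.1 ∈ U} => ((⟨p.1.1, p.2⟩ : U), p.1.2))
    (by fun_prop)).congr fun p => (extendZero_of_mem h p.2).symm

theorem continuousAt_extendZero {U : Opens X} (h : entireFamilies U) {p : X × ℂ} (hp : p.1 ∈ U) :
    ContinuousAt (extendZero h) p :=
  (continuousOn_extendZero h).continuousAt ((U.2.preimage continuous_fst).mem_nhds hp)

theorem differentiable_extendZero {U : Opens X} (h : entireFamilies U) (x : X) :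
    Differentiable ℂ fun z => extendZero h (x, z) := by
  by_cases hx : x ∈ U
  · simpa only [extendZero, dif_pos hx] using h.2.2 ⟨x, hx⟩
  · simp only [extendZero, dif_neg hx, differentiable_const]

variable {ι : Type*} (ρ : PartitionOfUnity ι X) {V : Opens X} {W : ι → Opens X}

/-- The entire family `∑ᵢ ρᵢ hᵢ` over `V`, for entire families `hᵢ` defined over `V ∩ supp ρᵢ`. -/
def weightedSum (h : ∀ i, entireFamilies (W i)) (hW : ∀ i, ∀ x ∈ V, x ∈ tsupport (ρ i) → x ∈ W i) :
    entireFamilies V where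
  val p := ∑ᶠ i, ρ i p.1 • extendZero (h i) (p.1, p.2)
  property := by
    constructor
    · let φ : C(V × ℂ, X) := ⟨fun p => p.1, by fun_prop⟩
      refine (pullbackPartition ρ φ).continuous_finsum_smul
        (g := fun i (p : V × ℂ) => extendZero (h i) (p.1, p.2)) fun i p hp => ?_
      have hpW : (p.1 : X) ∈ W i :=
        hW i p.1 p.1.2 (tsupport_pullbackPartition_subset ρ φ i hp)
      exact (continuousAt_extendZero (h i) (p := (↑p.1, p.2)) hpW).comp
        (f := fun p : V × ℂ => ((p.1 : X), p.2)) (by fun_prop)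
    · intro x
      have sum_eq (z : ℂ) : ∑ i ∈ ρ.finsupport (x : X), ρ i x • extendZero (h i) (x, z) =
          ∑ᶠ i, ρ i x • extendZero (h i) (x, z) :=
        ρ.sum_finsupport_smul_eq_finsum fun i y => extendZero (h i) (y, z)
      simp only [← sum_eq]
      exact Differentiable.fun_sum fun i _ =>
        (differentiable_extendZero (h i) x).fun_const_smul (ρ i x)

/-- The entire family underlying a section of `𝒪`. -/
def sectionVal {U : Opens X} (a : (sheafO X).obj (op U)) : entireFamilies U := a

theorem extendZero_add_extendZero_of_mem_cocycles {U : PointCover X}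
    {c : Cochain (sheafO X) U 1} (hc : c ∈ cocycles (sheafO X) U 1)
    {x y z : X} {p : X × ℂ} (hx : p.1 ∈ U.set x) (hy : p.1 ∈ U.set y) (hz : p.1 ∈ U.set z) :
    extendZero (sectionVal (c ![x, y])) p + extendZero (sectionVal (c ![y, z])) p =
      extendZero (sectionVal (c ![x, z])) p := by
  have mem_pair {a b : X} (ha : p.1 ∈ U.set a) (hb : p.1 ∈ U.set b) : p.1 ∈ U.inter ![a, b] :=
    PointCover.mem_inter.2 (Fin.forall_fin_two.2 ⟨ha, hb⟩)
  rw [extendZero_of_mem _ (mem_pair hx hy), extendZero_of_mem _ (mem_pair hy hz),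
    extendZero_of_mem _ (mem_pair hx hz)]
  exact congrFun (congrArg Subtype.val (res_add_res_of_mem_cocycles hc
    (V := U.set x ⊓ U.set y ⊓ U.set z) (inf_le_left.trans inf_le_left)
    (inf_le_left.trans inf_le_right) inf_le_right)) (⟨p.1, ⟨hx, hy⟩, hz⟩, p.2)

theorem cocycles_sheafO_le_coboundaries [T2Space X] [ParacompactSpace X] (U : PointCover X) :
    cocycles (sheafO X) U 1 ≤ coboundaries (sheafO X) U 1 := by
  intro c hc
  obtain ⟨ρ, hρ⟩ := PartitionOfUnity.exists_isSubordinate isClosed_univ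
    (fun x => (U.set x : Set X)) (fun x => (U.set x).2)
    (fun x _ => Set.mem_iUnion.2 ⟨x, U.mem x⟩)
  let e : ∀ y, entireFamilies (U.set y) := fun y =>
    weightedSum ρ (fun x => sectionVal (c ![x, y])) fun x _ hy hx =>
      PointCover.mem_inter.2 (Fin.forall_fin_two.2 ⟨hρ x hx, hy⟩)
  refine mem_coboundaries_one.2 ⟨e, fun s => Subtype.ext (funext fun p => Eq.symm ?_)⟩
  refine finsum_smul_sub_finsum_smul ρ (Set.mem_univ (p.1 : X)) fun x hx => ?_
  have pair_eta : ![s 0, s 1] = s := funext (Fin.forall_fin_two.2 ⟨rfl, rfl⟩)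
  rw [sub_eq_iff_eq_add', ← extendZero_add_extendZero_of_mem_cocycles hc (hρ x hx)
    (U.inter_le s 0 p.1.2) (U.inter_le s 1 p.1.2), pair_eta]
  exact congrArg _ (extendZero_of_mem (sectionVal (c s)) p.1.2)

end Vanishing

/-! ### Quotients of entire functions with the same simple zeros -/

section Ratio

/-- The quotient `f / g` of two entire functions with the same simple zeros, with the singularities
removed: at a zero of `g` the value is the one given by l'Hôpital's rule. -/
def ratio (f g : ℂ → ℂ) (z : ℂ) : ℂ :=
  open Classical in if g z = 0 then deriv f z / deriv g z else f z / g z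

variable {f g : ℂ → ℂ}

theorem ratio_mul {z : ℂ} (hgf : g z = 0 → f z = 0) : ratio f g z * g z = f z := by
  by_cases hz : g z = 0
  · rw [hz, mul_zero, hgf hz]
  · rw [ratio, if_neg hz, div_mul_cancel₀ _ hz]

theorem ratio_ne_zero {z : ℂ} (hfg : f z = 0 ↔ g z = 0) (hf : f z = 0 → deriv f z ≠ 0)
    (hg : g z = 0 → deriv g z ≠ 0) : ratio f g z ≠ 0 := by
  by_cases hz : g z = 0
  · rw [ratio, if_pos hz]
    exact div_ne_zero (hf (hfg.2 hz)) (hg hz)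
  · rw [ratio, if_neg hz]
    exact div_ne_zero (mt hfg.1 hz) hz

theorem ratio_eventuallyEq_div {a : ℂ} (hg : ContinuousAt g a) (ha : g a ≠ 0) :
    ratio f g =ᶠ[𝓝 a] f / g :=
  (hg.eventually_ne ha).mono fun _ hz => if_neg hz

theorem sub_mul_dslope_of_eq_zero {a : ℂ} (ha : f a = 0) (z : ℂ) :
    (z - a) * dslope f a z = f z := by
  simpa only [ha, sub_zero, smul_eq_mul] using sub_smul_dslope f a z

theorem ratio_eventuallyEq_dslope_div {a : ℂ} (hg : DifferentiableAt ℂ g a) (hfa : f a = 0)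
    (hga : g a = 0) (hg' : deriv g a ≠ 0) :
    ratio f g =ᶠ[𝓝 a] dslope f a / dslope g a := by
  have dslope_ne : dslope g a a ≠ 0 := by rwa [dslope_same]
  filter_upwards [(continuousAt_dslope_same.2 hg).eventually_ne dslope_ne] with z hz
  rcases eq_or_ne z a with rfl | hza
  · simp only [ratio, if_pos hga, Pi.div_apply, dslope_same]
  · have hgz : g z ≠ 0 := by
      rw [← sub_mul_dslope_of_eq_zero hga]
      exact mul_ne_zero (sub_ne_zero.2 hza) hz
    rw [ratio, if_neg hgz, ← sub_mul_dslope_of_eq_zero hfa, ← sub_mul_dslope_of_eq_zero hga,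
      mul_div_mul_left _ _ (sub_ne_zero.2 hza), Pi.div_apply]

theorem differentiable_ratio (hf : Differentiable ℂ f) (hg : Differentiable ℂ g)
    (hgf : ∀ z, g z = 0 → f z = 0) (hg' : ∀ z, g z = 0 → deriv g z ≠ 0) :
    Differentiable ℂ (ratio f g) := by
  have differentiableAt_dslope {k : ℂ → ℂ} (hk : Differentiable ℂ k) (a : ℂ) :
      DifferentiableAt ℂ (dslope k a) a :=
    ((Complex.differentiableOn_dslope univ_mem).2 hk.differentiableOn).differentiableAt univ_mem
  intro a
  by_cases ha : g a = 0
  · have dslope_ne : dslope g a a ≠ 0 := by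
      rw [dslope_same]
      exact hg' a ha
    exact ((differentiableAt_dslope hf a).div (differentiableAt_dslope hg a)
      dslope_ne).congr_of_eventuallyEq
      (ratio_eventuallyEq_dslope_div (hg a) (hgf a ha) ha (hg' a ha))
  · exact ((hf a).div (hg a) ha).congr_of_eventuallyEq
      (ratio_eventuallyEq_div (hg a).continuousAt ha)

/-- By the maximum principle, the differences `H (y, ·) - H (y₀, ·)` are as small on the disc as
they are on the circle. -/
theorem continuousAt_of_continuousAt_sphere {Y : Type*} [TopologicalSpace Y] {H : Y × ℂ → ℂ}
    (hd : ∀ y, Differentiable ℂ fun z => H (y, z)) {y₀ : Y} {z₀ : ℂ} {r : ℝ} (hr : 0 < r)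
    (hc : ∀ ζ ∈ Metric.sphere z₀ r, ContinuousAt H (y₀, ζ)) : ContinuousAt H (y₀, z₀) := by
  rw [Metric.continuousAt_iff']
  intro ε hε
  have near_sphere : ∀ᶠ y in 𝓝 y₀, ∀ ζ ∈ Metric.sphere z₀ r,
      dist (H (y, ζ)) (H (y₀, ζ)) < ε / 2 := by
    refine (isCompact_sphere z₀ r).eventually_forall_of_forall_eventually fun ζ hζ => ?_
    have continuousAt_base : ContinuousAt (fun q : Y × ℂ => H (y₀, q.2)) (y₀, ζ) :=
      ((hd y₀).continuous.comp continuous_snd).continuousAt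
    exact ((hc ζ hζ).dist continuousAt_base).eventually_lt continuousAt_const
      (by simpa only [dist_self] using half_pos hε)
  have near_centre : ∀ᶠ z in 𝓝 z₀, dist (H (y₀, z)) (H (y₀, z₀)) < ε / 2 :=
    (hd y₀).continuous.continuousAt.eventually (Metric.ball_mem_nhds _ (half_pos hε))
  filter_upwards [near_sphere.prod_nhds (near_centre.and (Metric.ball_mem_nhds z₀ hr))]
    with ⟨y, z⟩ ⟨hy, hz, hzr⟩
  have dist_le : dist (H (y, z)) (H (y₀, z)) ≤ ε / 2 := by
    rw [dist_eq_norm]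
    refine Complex.norm_le_of_forall_mem_frontier_norm_le (f := fun z => H (y, z) - H (y₀, z))
      Metric.isBounded_ball ((hd y).sub (hd y₀)).diffContOnCl (fun ζ hζ => ?_)
      (subset_closure hzr)
    rw [frontier_ball z₀ hr.ne'] at hζ
    exact (dist_eq_norm (H (y, ζ)) _ ▸ hy ζ hζ).le
  calc dist (H (y, z)) (H (y₀, z₀))
      ≤ dist (H (y, z)) (H (y₀, z)) + dist (H (y₀, z)) (H (y₀, z₀)) := dist_triangle _ _ _
    _ < ε / 2 + ε / 2 := add_lt_add_of_le_of_lt dist_le hz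
    _ = ε := add_halves ε

end Ratio

/-! ### Local realizations -/

section Realization

variable {X : Type u} [TopologicalSpace X] {E : Set (X × ℂ)}

namespace IsLocalRealization

variable {U V : Opens X} {F G : entireFamilies U}

theorem restrict (hF : IsLocalRealization E U F) (h : V ≤ U) :
    IsLocalRealization E V (restrict h F) :=
  fun x z => hF (Set.inclusion h x) z

theorem eventually_ne (hF : IsLocalRealization E U F) (x : U) (z : ℂ) :
    ∀ᶠ w in 𝓝[≠] z, F.1 (x, w) ≠ 0 := by
  by_cases hz : F.1 (x, z) = 0
  · exact (F.2.2 x z).hasDerivAt.eventually_ne ((hF x z).2 hz)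
  · exact nhdsWithin_le_nhds ((F.2.2 x z).continuousAt.eventually_ne hz)

theorem mul_right_cancel (hF : IsLocalRealization E U F) {a b : entireFamilies U}
    (h : a * F = b * F) : a = b := by
  refine Subtype.ext (funext fun p => ?_)
  have dense_ne : Dense {w | F.1 (p.1, w) ≠ 0} := fun z =>
    mem_closure_iff_frequently.2
      ((hF.eventually_ne p.1 z).frequently.filter_mono nhdsWithin_le_nhds)
  refine congrFun (Continuous.ext_on dense_ne (a.2.2 p.1).continuous (b.2.2 p.1).continuous
    fun w hw => ?_) p.2
  exact mul_right_cancel₀ hw (congrFun (congrArg Subtype.val h) (p.1, w))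

theorem unit_mul (hF : IsLocalRealization E U F) (v : (entireFamilies U)ˣ) :
    IsLocalRealization E U (v * F) := by
  intro x z
  have v_ne : (v : entireFamilies U).1 (x, z) ≠ 0 := (isUnit_iff_ne_zero _).1 v.isUnit (x, z)
  have zero_iff : ((v : entireFamilies U) * F).1 (x, z) = 0 ↔ F.1 (x, z) = 0 :=
    mul_eq_zero_iff_left v_ne
  refine ⟨zero_iff.trans (hF x z).1, fun hz => ?_⟩
  have hFz := zero_iff.1 hz
  have deriv_eq := deriv_fun_mul ((v : entireFamilies U).2.2 x z) (F.2.2 x z)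
  rw [hFz, mul_zero, zero_add] at deriv_eq
  exact ne_of_eq_of_ne deriv_eq (mul_ne_zero v_ne ((hF x z).2 hFz))

theorem continuous_ratio (hG : IsLocalRealization E U G)
    (hd : ∀ x, Differentiable ℂ (ratio (fun z => F.1 (x, z)) fun z => G.1 (x, z))) :
    Continuous fun p : U × ℂ => ratio (fun z => F.1 (p.1, z)) (fun z => G.1 (p.1, z)) p.2 := by
  refine continuous_iff_continuousAt.2 fun ⟨x, z⟩ => ?_
  obtain ⟨r, hr, G_ne⟩ := Metric.mem_nhdsWithin_iff.1 (hG.eventually_ne x z)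
  refine continuousAt_of_continuousAt_sphere hd (half_pos hr) fun ζ hζ => ?_
  have hζr : ζ ∈ Metric.ball z r := Metric.sphere_subset_ball (half_lt_self hr) hζ
  have hζz : ζ ≠ z := Metric.ne_of_mem_sphere hζ (half_pos hr).ne'
  have hGζ : G.1 (x, ζ) ≠ 0 := G_ne ⟨hζr, hζz⟩
  refine (F.2.1.continuousAt.div G.2.1.continuousAt hGζ).congr ?_
  exact (G.2.1.continuousAt.eventually_ne hGζ).mono fun q hq => (if_neg hq).symm

theorem exists_eq_unit_mul (hF : IsLocalRealization E U F) (hG : IsLocalRealization E U G) :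
    ∃ v : (entireFamilies U)ˣ, F = v * G := by
  have zero_iff (x : U) (z : ℂ) : F.1 (x, z) = 0 ↔ G.1 (x, z) = 0 :=
    (hF x z).1.trans (hG x z).1.symm
  have hd (x : U) : Differentiable ℂ (ratio (fun z => F.1 (x, z)) fun z => G.1 (x, z)) :=
    differentiable_ratio (F.2.2 x) (G.2.2 x) (fun z => (zero_iff x z).2) fun z => (hG x z).2
  let v : entireFamilies U := ⟨_, hG.continuous_ratio hd, hd⟩
  have isUnit_v : IsUnit v := (isUnit_iff_ne_zero v).2 fun p =>
    ratio_ne_zero (f := fun z => F.1 (p.1, z)) (g := fun z => G.1 (p.1, z)) (zero_iff p.1 p.2)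
      (hF p.1 p.2).2 (hG p.1 p.2).2
  exact ⟨isUnit_v.unit, Subtype.ext (funext fun p => (ratio_mul (f := fun z => F.1 (p.1, z))
    (g := fun z => G.1 (p.1, z)) (zero_iff p.1 p.2).2).symm)⟩

end IsLocalRealization

theorem exists_glue {U : PointCover X} (G : ∀ x, entireFamilies (U.set x))
    (hG : ∀ s : Fin 2 → X,
      restrict (U.inter_le s 0) (G (s 0)) = restrict (U.inter_le s 1) (G (s 1))) :
    ∃ F : X × ℂ → ℂ, Continuous F ∧ (∀ x, Differentiable ℂ fun z => F (x, z)) ∧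
      ∀ (x : X) (p : U.set x × ℂ), F (p.1, p.2) = (G x).1 p := by
  let F : X × ℂ → ℂ := fun p => (G p.1).1 (⟨p.1, U.mem p.1⟩, p.2)
  have F_eq (x : X) (p : U.set x × ℂ) : F (p.1, p.2) = (G x).1 p :=
    congrFun (congrArg Subtype.val (hG ![p.1, x])) (⟨p.1, PointCover.mem_inter.2
      (Fin.forall_fin_two.2 ⟨U.mem p.1, p.1.2⟩)⟩, p.2)
  refine ⟨F, continuous_iff_continuousAt.2 fun p => ?_, fun x => (G x).2.2 ⟨x, U.mem x⟩, F_eq⟩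
  refine (continuousAt_extendZero (G p.1) (U.mem p.1)).congr ?_
  filter_upwards [((U.set p.1).2.preimage continuous_fst).mem_nhds (U.mem p.1)] with q hq
  exact (extendZero_of_mem (G p.1) hq).trans (F_eq p.1 (⟨q.1, hq⟩, q.2)).symm

theorem isRealizable_of_restrict_eq (hE : IsCountableCovering E) {U : PointCover X}
    {G : ∀ x, entireFamilies (U.set x)} (hG : ∀ x, IsLocalRealization E (U.set x) (G x))
    (h : ∀ s : Fin 2 → X,
      restrict (U.inter_le s 0) (G (s 0)) = restrict (U.inter_le s 1) (G (s 1))) :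
    IsRealizable E := by
  obtain ⟨F, F_continuous, F_entire, F_eq⟩ := exists_glue G h
  have F_slice (x : X) : (fun z => F (x, z)) = fun z => (G x).1 (⟨x, U.mem x⟩, z) :=
    funext fun z => F_eq x (⟨x, U.mem x⟩, z)
  have zeroLocus_eq : zeroLocus F = E := Set.ext fun ⟨x, z⟩ => by
    rw [← (hG x ⟨x, U.mem x⟩ z).1, ← F_eq]
    rfl
  refine ⟨F, ⟨F_continuous, F_entire, zeroLocus_eq ▸ hE⟩, fun x z hz => ?_, zeroLocus_eq⟩
  rw [F_slice]
  exact (hG x ⟨x, U.mem x⟩ z).2 (F_eq x (⟨x, U.mem x⟩, z) ▸ hz)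

theorem IsRealizable.exists_isLocalRealization_top (hE : IsRealizable E) :
    ∃ F : entireFamilies (⊤ : Opens X), IsLocalRealization E ⊤ F := by
  obtain ⟨F, hF, hF', rfl⟩ := hE
  exact ⟨⟨fun p => F (p.1, p.2), hF.continuous.comp (by fun_prop), fun x => hF.entire x⟩,
    fun x z => ⟨Iff.rfl, hF' x z⟩⟩

end Realization

/-! ### The cocycle of ratios -/

section RatioCocycle

variable {X : Type u} [TopologicalSpace X] {E : Set (X × ℂ)} {U V : Opens X}

/-- The entire family underlying a section of `𝒪ˣ`. -/
def unitVal (a : (sheafOUnits X).obj (op U)) : entireFamilies U :=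
  ((Additive.toMul (a : Additive (entireFamilies U)ˣ) : (entireFamilies U)ˣ) : entireFamilies U)

theorem unitVal_injective :
    Function.Injective (unitVal : (sheafOUnits X).obj (op U) → entireFamilies U) :=
  fun _ _ h => Additive.toMul.injective (Units.ext h)

theorem unitVal_add (a b : (sheafOUnits X).obj (op U)) :
    unitVal (a + b) = unitVal a * unitVal b := rfl

theorem exists_isRatioCocycle {U : PointCover X} {F : ∀ x, entireFamilies (U.set x)}
    (hF : ∀ x, IsLocalRealization E (U.set x) (F x)) : ∃ h, IsRatioCocycle U F h := by
  choose h hh using fun s : Fin 2 → X => ((hF (s 0)).restrict (U.inter_le s 0)).exists_eq_unit_mul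
    ((hF (s 1)).restrict (U.inter_le s 1))
  let c : Cochain (sheafOUnits X) U 1 := fun s => Additive.ofMul (h s)
  have restrict_eq {x y : X} {V : Opens X} (hx : V ≤ U.set x) (hy : V ≤ U.set y) :
      restrict hx (F x) = unitVal (res (sheafOUnits X) (PointCover.le_inter_pair hx hy)
        (c ![x, y])) * restrict hy (F y) :=
    congrArg (restrict (PointCover.le_inter_pair hx hy)) (hh ![x, y])
  refine ⟨⟨c, mem_cocycles_one.2 fun s => unitVal_injective ?_⟩, hh⟩
  refine ((hF (s 2)).restrict (U.inter_le s 2)).mul_right_cancel ?_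
  rw [unitVal_add, mul_assoc, ← restrict_eq (U.inter_le s 0), ← restrict_eq (U.inter_le s 1),
    ← restrict_eq (U.inter_le s 0)]

theorem isRatioCocycle_zero (F : entireFamilies (⊤ : Opens X)) :
    IsRatioCocycle ⟨fun _ => ⊤, fun _ => trivial⟩ (fun _ => F) 0 :=
  fun s => (one_mul (restrict (PointCover.inter_le ⟨fun _ => ⊤, fun _ => trivial⟩ s 0) F)).symm

namespace IsRatioCocycle

variable {U : PointCover X} {F : ∀ x, entireFamilies (U.set x)}
  {h : cocycles (sheafOUnits X) U 1}

theorem restrict_eq (hh : IsRatioCocycle U F h) {V : PointCover X} (k : U ≤ V) (s : Fin 2 → X) :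
    restrict (V.inter_le s 0) (restrict (k (s 0)) (F (s 0))) =
      unitVal (refine (sheafOUnits X) k 1 h s) *
        restrict (V.inter_le s 1) (restrict (k (s 1)) (F (s 1))) :=
  congrArg (restrict (PointCover.inter_mono k s)) (hh s)

theorem cechClass_eq {U' : PointCover X} {F' : ∀ x, entireFamilies (U'.set x)}
    {h' : cocycles (sheafOUnits X) U' 1} (hh : IsRatioCocycle U F h)
    (hh' : IsRatioCocycle U' F' h') (hF : ∀ x, IsLocalRealization E (U.set x) (F x))
    (hF' : ∀ x, IsLocalRealization E (U'.set x) (F' x)) :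
    cechClass (sheafOUnits X) U 1 h = cechClass (sheafOUnits X) U' 1 h' := by
  obtain ⟨W, k, k'⟩ := exists_ge_ge U U'
  choose g hg using fun x => ((hF' x).restrict (k' x)).exists_eq_unit_mul ((hF x).restrict (k x))
  let γ : ∀ x, (sheafOUnits X).obj (op (W.set x)) := fun x => Additive.ofMul (g x)
  have restrict_F' (s : Fin 2 → X) (i : Fin 2) :
      restrict (W.inter_le s i) (restrict (k' (s i)) (F' (s i))) =
        unitVal (res _ (W.inter_le s i) (γ (s i))) *
          restrict (W.inter_le s i) (restrict (k (s i)) (F (s i))) :=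
    congrArg (restrict (W.inter_le s i)) (hg (s i))
  refine cechClass_eq_cechClass_iff.2 ⟨W, k, k', mem_coboundaries_one.2 ⟨γ, fun s => ?_⟩⟩
  rw [Pi.sub_apply, sub_eq_sub_iff_add_eq_add]
  refine unitVal_injective
    ((((hF (s 1)).restrict (k (s 1))).restrict (W.inter_le s 1)).mul_right_cancel ?_)
  rw [unitVal_add, unitVal_add, mul_right_comm, ← hh.restrict_eq k, mul_comm, ← restrict_F' s 0,
    hh'.restrict_eq k', restrict_F' s 1]
  ring

theorem isRealizable (hh : IsRatioCocycle U F h) (hE : IsCountableCovering E)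
    (hF : ∀ x, IsLocalRealization E (U.set x) (F x))
    (h_zero : cechClass (sheafOUnits X) U 1 h = 0) : IsRealizable E := by
  obtain ⟨V, k, hV⟩ := cechClass_eq_zero_iff.1 h_zero
  obtain ⟨g, hg⟩ := mem_coboundaries_one.1 hV
  refine isRealizable_of_restrict_eq hE
    (fun x => ((hF x).restrict (k x)).unit_mul (Additive.toMul (g x))) fun s => ?_
  change unitVal (res _ (V.inter_le s 0) (g (s 0))) *
      restrict (V.inter_le s 0) (restrict (k (s 0)) (F (s 0))) =
    unitVal (res _ (V.inter_le s 1) (g (s 1))) *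
      restrict (V.inter_le s 1) (restrict (k (s 1)) (F (s 1)))
  rw [hh.restrict_eq k, ← mul_assoc, ← unitVal_add, hg, add_sub_cancel]

end IsRatioCocycle

end RatioCocycle

/-! ### Weierstrass products -/

section InfiniteProduct

theorem continuousAt_tprod_one_add {ι T R : Type*} [TopologicalSpace T] [NormedCommRing R]
    [NormOneClass R] [CompleteSpace R] {f : ι → T → R} {u : ι → ℝ} {t₀ : T} (hu : Summable u)
    (hf : ∀ i, ContinuousAt (f i) t₀)
    (h : ∀ᶠ q : ι × T in cofinite ×ˢ 𝓝 t₀, ‖f q.1 q.2‖ ≤ u q.1) :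
    ContinuousAt (fun t => ∏' i, (1 + f i t)) t₀ := by
  classical
  obtain ⟨P, hP, Q, hQ, bound⟩ := eventually_prod_iff.1 h
  have near_exceptions : ∀ᶠ t in 𝓝 t₀, ∀ i ∈ {i | ¬P i}, ‖f i t‖ ≤ ‖f i t₀‖ + 1 :=
    (eventually_all_finite hP).2 fun i _ =>
      (hf i).norm.eventually (eventually_le_nhds (lt_add_one _))
  have summable_bound : Summable fun i => if P i then u i else ‖f i t₀‖ + 1 :=
    hu.congr_cofinite (hP.mono fun i hi => (if_pos hi).symm)
  refine tendsto_tprod_one_add_of_dominated_convergence summable_bound hf ?_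
  filter_upwards [hQ, near_exceptions] with t htQ ht i
  split_ifs with hi
  · exact bound hi htQ
  · exact ht i hi

theorem differentiableAt_tprod_one_add {ι : Type*} {f : ι → ℂ → ℂ} {u : ι → ℝ} {z₀ : ℂ}
    (hu : Summable u) (hf : ∀ i, Differentiable ℂ (f i))
    (h : ∀ᶠ q : ι × ℂ in cofinite ×ˢ 𝓝 z₀, ‖f q.1 q.2‖ ≤ u q.1) :
    DifferentiableAt ℂ (fun z => ∏' i, (1 + f i z)) z₀ := by
  obtain ⟨P, hP, Q, hQ, bound⟩ := eventually_prod_iff.1 h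
  obtain ⟨A, hAQ, hA, hzA⟩ := eventually_nhds_iff.1 hQ
  have uniform := hu.hasProdLocallyUniformlyOn_one_add hA
    (hP.mono fun i hi z hz => bound hi (hAQ z hz)) fun i => (hf i).continuous.continuousOn
  refine (uniform.differentiableOn ?_ hA).differentiableAt (hA.mem_nhds hzA)
  exact Eventually.of_forall fun S => DifferentiableOn.fun_finsetProd fun i _ =>
    ((hf i).const_add 1).differentiableOn

end InfiniteProduct

section ElementaryFactor

theorem elementaryFactor_eq_zero_iff {p : ℕ} {w : ℂ} : elementaryFactor p w = 0 ↔ w = 1 := by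
  rw [elementaryFactor, mul_eq_zero, or_iff_left (Complex.exp_ne_zero _), sub_eq_zero, eq_comm]

theorem elementaryFactor_zero (p : ℕ) : elementaryFactor p 0 = 1 := by
  have sum_eq_zero : ∑ k ∈ Finset.Icc 1 p, (0 : ℂ) ^ k / k = 0 :=
    Finset.sum_eq_zero fun k hk => by
      rw [zero_pow (Nat.one_le_iff_ne_zero.1 (Finset.mem_Icc.1 hk).1), zero_div]
  rw [elementaryFactor, sum_eq_zero, sub_zero, Complex.exp_zero, mul_one]

theorem differentiable_elementaryFactor (p : ℕ) : Differentiable ℂ (elementaryFactor p) := by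
  unfold elementaryFactor
  fun_prop

theorem deriv_elementaryFactor_one_ne_zero (p : ℕ) : deriv (elementaryFactor p) 1 ≠ 0 := by
  let e : ℂ → ℂ := fun w => Complex.exp (∑ k ∈ Finset.Icc 1 p, w ^ k / k)
  have he : DifferentiableAt ℂ e 1 := by fun_prop
  have hasDerivAt_factor : HasDerivAt (elementaryFactor p) (-1 * e 1 + (1 - 1) * deriv e 1) 1 :=
    ((hasDerivAt_id (1 : ℂ)).const_sub 1).mul he.hasDerivAt
  rw [hasDerivAt_factor.deriv, sub_self, zero_mul, add_zero]
  exact mul_ne_zero (neg_ne_zero.2 one_ne_zero) (Complex.exp_ne_zero _)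

theorem elementaryFactor_eq_exp {p : ℕ} {w : ℂ} (hw : w ≠ 1) :
    elementaryFactor p w =
      Complex.exp (Complex.log (1 + -w) - Complex.logTaylor (p + 1) (-w)) := by
  have logTaylor_neg :
      Complex.logTaylor (p + 1) (-w) = -∑ k ∈ Finset.Icc 1 p, w ^ k / k := by
    rw [Complex.logTaylor, Finset.sum_range_succ', ← Finset.sum_neg_distrib,
      Finset.range_eq_Ico,
      Finset.sum_Ico_add' (fun j : ℕ => (-1 : ℂ) ^ (j + 1) * (-w) ^ j / j) 0 p 1,
      Nat.cast_zero, div_zero, add_zero]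
    refine Finset.sum_congr rfl fun k _ => ?_
    rw [neg_pow w, pow_succ, mul_neg_one, neg_mul, ← mul_assoc, ← mul_pow, neg_one_mul, neg_neg,
      one_pow, one_mul, neg_div]
  rw [logTaylor_neg, sub_neg_eq_add, ← sub_eq_add_neg, Complex.exp_add,
    Complex.exp_log (sub_ne_zero.2 hw.symm), elementaryFactor]

theorem norm_log_sub_logTaylor_le_of_norm_le_half (p : ℕ) {w : ℂ} (hw : ‖w‖ ≤ 1 / 2) :
    ‖Complex.log (1 + w) - Complex.logTaylor (p + 1) w‖ ≤ (1 / 2) ^ p := by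
  have inv_le_two : (1 - ‖w‖)⁻¹ ≤ 2 := inv_le_of_inv_le₀ two_pos (by linarith)
  have inv_nonneg : 0 ≤ (1 - ‖w‖)⁻¹ := inv_nonneg.2 (by linarith)
  calc ‖Complex.log (1 + w) - Complex.logTaylor (p + 1) w‖
      ≤ ‖w‖ ^ (p + 1) * (1 - ‖w‖)⁻¹ / (p + 1) :=
        Complex.norm_log_sub_logTaylor_le p (hw.trans_lt one_half_lt_one)
    _ ≤ ‖w‖ ^ (p + 1) * (1 - ‖w‖)⁻¹ :=
        div_le_self (by positivity) (by linarith [p.cast_nonneg (α := ℝ)])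
    _ ≤ (1 / 2) ^ (p + 1) * 2 := by gcongr
    _ = (1 / 2) ^ p := by rw [pow_succ, mul_assoc, one_div_mul_cancel two_ne_zero, mul_one]

theorem norm_elementaryFactor_sub_one_le (p : ℕ) {w : ℂ} (hw : ‖w‖ ≤ 1 / 2) :
    ‖elementaryFactor p w - 1‖ ≤ 2 * (1 / 2) ^ p := by
  have hw_ne : w ≠ 1 := by
    rintro rfl
    norm_num at hw
  have log_le := norm_log_sub_logTaylor_le_of_norm_le_half p ((norm_neg w).trans_le hw)
  rw [elementaryFactor_eq_exp hw_ne]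
  exact (Complex.norm_exp_sub_one_le
    (log_le.trans (pow_le_one₀ one_half_pos.le one_half_lt_one.le))).trans (by gcongr)

end ElementaryFactor

section WeierstrassProduct

/-- The Weierstrass product `∏ₙ 𝓔ₙ(wₙ)`, with `n` starting at `1`; here the sequence `w` is indexed
from `0`, so the factor of index `n` has degree `n + 1`. -/
def weierstrassProduct (w : ℕ → ℂ) : ℂ := ∏' n, elementaryFactor (n + 1) (w n)

theorem summable_two_mul_half_pow_succ : Summable fun n : ℕ => 2 * (1 / 2 : ℝ) ^ (n + 1) :=
  ((summable_nat_add_iff 1).2 summable_geometric_two).mul_left 2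

theorem weierstrassProduct_eq_tprod_one_add (w : ℕ → ℂ) :
    weierstrassProduct w = ∏' n, (1 + (elementaryFactor (n + 1) (w n) - 1)) :=
  tprod_congr fun _ => (add_sub_cancel _ _).symm

section Sequence

variable {w : ℕ → ℂ} (hw : Tendsto w cofinite (𝓝 0))

include hw

theorem summable_norm_elementaryFactor_sub_one :
    Summable fun n => ‖elementaryFactor (n + 1) (w n) - 1‖ := by
  refine summable_two_mul_half_pow_succ.of_norm_bounded_eventually ?_
  filter_upwards [hw.norm.eventually_le_const (norm_zero.trans_lt one_half_pos)] with n hn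
  exact (norm_norm _).trans_le (norm_elementaryFactor_sub_one_le (n + 1) hn)

theorem hasProd_weierstrassProduct :
    HasProd (fun n => elementaryFactor (n + 1) (w n)) (weierstrassProduct w) := by
  have multipliable := multipliable_one_add_of_summable (summable_norm_elementaryFactor_sub_one hw)
  exact (multipliable.congr fun _ => add_sub_cancel _ _).hasProd

theorem weierstrassProduct_eq_zero_iff : weierstrassProduct w = 0 ↔ ∃ n, w n = 1 := by
  refine ⟨fun h => ?_, fun ⟨n, hn⟩ =>
    tprod_of_exists_eq_zero ⟨n, elementaryFactor_eq_zero_iff.2 hn⟩⟩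
  by_contra! w_ne
  rw [weierstrassProduct_eq_tprod_one_add] at h
  refine tprod_one_add_ne_zero_of_summable (fun n => ?_)
    (summable_norm_elementaryFactor_sub_one hw) h
  rw [add_sub_cancel]
  exact mt elementaryFactor_eq_zero_iff.1 (w_ne n)

theorem tendsto_update_zero (m : ℕ) : Tendsto (Function.update w m 0) cofinite (𝓝 0) :=
  hw.congr' ((Set.finite_singleton m).eventually_cofinite_notMem.mono fun _ hn =>
    (Function.update_of_ne hn _ _).symm)

theorem weierstrassProduct_eq_mul_update (m : ℕ) :
    weierstrassProduct w =
      elementaryFactor (m + 1) (w m) * weierstrassProduct (Function.update w m 0) := by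
  have update_eq : Function.update (fun n => elementaryFactor (n + 1) (w n)) m 1 =
      fun n => elementaryFactor (n + 1) (Function.update w m 0 n) := by
    rw [← elementaryFactor_zero (m + 1)]
    exact funext fun n => (Function.apply_update (fun k => elementaryFactor (k + 1)) w m 0 n).symm
  have hasProd_update := hasProd_weierstrassProduct (tendsto_update_zero hw m)
  rw [← update_eq] at hasProd_update
  rw [mul_comm, ← (hasProd_weierstrassProduct hw).update' m 1 hasProd_update, mul_one]

end Sequence

section Family

variable {T : Type*} [TopologicalSpace T]

theorem eventually_norm_elementaryFactor_sub_one_le {w : ℕ → T → ℂ} {t₀ : T}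
    (hw : Tendsto (fun q : ℕ × T => w q.1 q.2) (cofinite ×ˢ 𝓝 t₀) (𝓝 0)) :
    ∀ᶠ q : ℕ × T in cofinite ×ˢ 𝓝 t₀,
      ‖elementaryFactor (q.1 + 1) (w q.1 q.2) - 1‖ ≤ 2 * (1 / 2) ^ (q.1 + 1) :=
  (hw.norm.eventually_le_const (norm_zero.trans_lt one_half_pos)).mono fun q hq =>
    norm_elementaryFactor_sub_one_le (q.1 + 1) hq

theorem continuousAt_weierstrassProduct {w : ℕ → T → ℂ} {t₀ : T}
    (hc : ∀ n, ContinuousAt (w n) t₀)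
    (hw : Tendsto (fun q : ℕ × T => w q.1 q.2) (cofinite ×ˢ 𝓝 t₀) (𝓝 0)) :
    ContinuousAt (fun t => weierstrassProduct fun n => w n t) t₀ := by
  simp only [weierstrassProduct_eq_tprod_one_add]
  refine continuousAt_tprod_one_add summable_two_mul_half_pow_succ (fun n => ?_)
    (eventually_norm_elementaryFactor_sub_one_le hw)
  exact ((differentiable_elementaryFactor (n + 1)).continuous.continuousAt.comp (hc n)).sub
    continuousAt_const

variable {w : ℕ → ℂ → ℂ} (hd : ∀ n, Differentiable ℂ (w n))
  (hw : ∀ z₀, Tendsto (fun q : ℕ × ℂ => w q.1 q.2) (cofinite ×ˢ 𝓝 z₀) (𝓝 0))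

include hd hw

theorem differentiable_weierstrassProduct :
    Differentiable ℂ fun z => weierstrassProduct fun n => w n z := by
  simp only [weierstrassProduct_eq_tprod_one_add]
  exact fun z₀ => differentiableAt_tprod_one_add summable_two_mul_half_pow_succ
    (fun n => ((differentiable_elementaryFactor (n + 1)).comp (hd n)).sub_const 1)
    (eventually_norm_elementaryFactor_sub_one_le (hw z₀))

theorem exists_weierstrassProduct_eq_mul {z₀ : ℂ} {m : ℕ} (hm : ∀ n ≠ m, w n z₀ ≠ 1) :
    ∃ K : ℂ → ℂ, Differentiable ℂ K ∧ K z₀ ≠ 0 ∧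
      ∀ z, weierstrassProduct (fun n => w n z) = elementaryFactor (m + 1) (w m z) * K z := by
  let v : ℕ → ℂ → ℂ := Function.update w m 0
  have v_apply (z : ℂ) : (fun n => v n z) = Function.update (fun n => w n z) m 0 :=
    funext fun n => Function.apply_update (fun _ g => g z) w m 0 n
  have differentiable_v (n : ℕ) : Differentiable ℂ (v n) := by
    rcases eq_or_ne n m with rfl | hn
    · rw [show v n = 0 from Function.update_self n _ w]
      exact differentiable_const 0
    · rw [show v n = w n from Function.update_of_ne hn _ w]
      exact hd n
  have tendsto_v (z : ℂ) : Tendsto (fun q : ℕ × ℂ => v q.1 q.2) (cofinite ×ˢ 𝓝 z) (𝓝 0) := by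
    refine (hw z).congr' ?_
    filter_upwards [((Set.finite_singleton m).eventually_cofinite_notMem).prod_inl (𝓝 z)] with q hq
    exact congrFun (Function.update_of_ne hq _ w).symm q.2
  have tendsto_w_apply (z : ℂ) : Tendsto (fun n => w n z) cofinite (𝓝 0) :=
    (hw z).comp (tendsto_id.prodMk tendsto_const_nhds)
  refine ⟨fun z => weierstrassProduct fun n => v n z,
    differentiable_weierstrassProduct differentiable_v tendsto_v, ?_, fun z => ?_⟩
  · have tendsto_update := tendsto_update_zero (tendsto_w_apply z₀) m
    simp only [v_apply]
    rw [Ne, weierstrassProduct_eq_zero_iff tendsto_update]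
    rintro ⟨n, hn⟩
    rcases eq_or_ne n m with rfl | hnm
    · exact zero_ne_one ((Function.update_self ..).symm.trans hn)
    · exact hm n hnm ((Function.update_of_ne hnm ..).symm.trans hn)
  · simp only [v_apply]
    exact weierstrassProduct_eq_mul_update (tendsto_w_apply z) m

theorem deriv_weierstrassProduct_ne_zero {z₀ : ℂ} {m : ℕ} (hm : ∀ n, w n z₀ = 1 ↔ n = m)
    (hm' : deriv (w m) z₀ ≠ 0) :
    deriv (fun z => weierstrassProduct fun n => w n z) z₀ ≠ 0 := by
  obtain ⟨K, hK, K_ne_zero, product_eq⟩ :=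
    exists_weierstrassProduct_eq_mul hd hw fun n hn => mt (hm n).1 hn
  have factor_zero : w m z₀ = 1 := (hm m).2 rfl
  have hasDerivAt_factor : HasDerivAt (fun z => elementaryFactor (m + 1) (w m z))
      (deriv (elementaryFactor (m + 1)) 1 * deriv (w m) z₀) z₀ := by
    rw [← factor_zero]
    exact (differentiable_elementaryFactor (m + 1) _).hasDerivAt.comp z₀ (hd m z₀).hasDerivAt
  rw [funext product_eq, (hasDerivAt_factor.fun_mul (hK z₀).hasDerivAt).deriv, factor_zero,
    elementaryFactor_eq_zero_iff.2 rfl, zero_mul, add_zero]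
  exact mul_ne_zero (mul_ne_zero (deriv_elementaryFactor_one_ne_zero _) hm') K_ne_zero

end Family

end WeierstrassProduct

/-! ### Sheets of a covering -/

section Sheets

theorem tendsto_cocompact_of_disjoint_nhds {α Y : Type*} [TopologicalSpace Y] {l : Filter α}
    {f : α → Y} (h : ∀ y, Disjoint (𝓝 y) (map f l)) : Tendsto f l (cocompact Y) := by
  refine hasBasis_cocompact.tendsto_right_iff.2 fun K hK => ?_
  obtain ⟨A, hA, B, hB, hAB⟩ :=
    Filter.disjoint_iff.1 (hK.disjoint_nhdsSet_left.2 fun y _ => h y)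
  filter_upwards [mem_map.1 hB] with a ha haK
  exact Set.disjoint_left.1 hAB (subset_of_mem_nhdsSet hA haK) ha

variable {X : Type u} {Y ι : Type*} [TopologicalSpace X] [TopologicalSpace Y]

/-- Over the open set `U`, the set `E ⊆ X × Y` is the disjoint union of the graphs of the
continuous functions `s i`. -/
structure IsSheetFamily (E : Set (X × Y)) (U : Opens X) (s : ι → U → Y) : Prop where
  continuous : ∀ i, Continuous (s i)
  injective : ∀ x, Function.Injective fun i => s i x
  mem_iff : ∀ (x : U) (y : Y), ((x : X), y) ∈ E ↔ ∃ i, s i x = y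

variable {E : Set (X × Y)} {U V : Opens X} {s : ι → U → Y}

namespace IsSheetFamily

theorem restrict (hs : IsSheetFamily E U s) (h : V ≤ U) :
    IsSheetFamily E V fun i x => s i (Set.inclusion h x) where
  continuous i := (hs.continuous i).comp (continuous_inclusion h)
  injective x := hs.injective (Set.inclusion h x)
  mem_iff x := hs.mem_iff (Set.inclusion h x)

theorem mem (hs : IsSheetFamily E U s) (i : ι) (x : U) : ((x : X), s i x) ∈ E :=
  (hs.mem_iff x _).2 ⟨i, rfl⟩

theorem isOpenEmbedding (hs : IsSheetFamily E U s)
    (hE : IsLocalHomeomorph fun e : E => e.1.1) (i : ι) :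
    IsOpenEmbedding fun x : U => (⟨(x, s i x), hs.mem i x⟩ : E) :=
  hE.isOpenEmbedding_of_comp U.isOpen.isOpenEmbedding_subtypeVal
    ((continuous_subtype_val.prodMk (hs.continuous i)).subtype_mk _)

theorem exists_finite_index (hs : IsSheetFamily E U s)
    (hE : IsLocalHomeomorph fun e : E => e.1.1) (hc : IsClosed E) (x₀ : U) (y₀ : Y) :
    ∃ S : Set ι, S.Finite ∧ ∀ᶠ p : U × Y in 𝓝 (x₀, y₀), ∀ i, s i p.1 = p.2 → i ∈ S := by
  have incl_continuous : Continuous fun p : U × Y => ((p.1 : X), p.2) := by fun_prop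
  by_cases hy : ((x₀ : X), y₀) ∈ E
  · obtain ⟨m, rfl⟩ := (hs.mem_iff x₀ y₀).1 hy
    obtain ⟨O, hO, hOE⟩ := isOpen_induced_iff.1 (hs.isOpenEmbedding hE m).isOpen_range
    have center_mem : (⟨_, hy⟩ : E) ∈ Subtype.val ⁻¹' O := hOE ▸ Set.mem_range_self x₀
    refine ⟨{m}, Set.finite_singleton m, ?_⟩
    filter_upwards [incl_continuous.continuousAt.eventually (hO.mem_nhds center_mem)]
      with ⟨x, y⟩ hxy i hi
    obtain rfl : s i x = y := hi
    have mem_sheet : (⟨_, hs.mem i x⟩ : E) ∈ Subtype.val ⁻¹' O := hxy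
    rw [hOE] at mem_sheet
    obtain ⟨x', hx'⟩ := mem_sheet
    obtain ⟨hxx', hs_eq⟩ := Prod.ext_iff.1 (congrArg Subtype.val hx')
    obtain rfl := Subtype.ext hxx'
    exact (hs.injective x' hs_eq).symm
  · refine ⟨∅, Set.finite_empty, ?_⟩
    filter_upwards [incl_continuous.continuousAt.eventually (hc.isOpen_compl.mem_nhds hy)]
      with ⟨x, y⟩ hxy i hi
    exact hxy (hi ▸ hs.mem i x)

theorem tendsto_cocompact (hs : IsSheetFamily E U s)
    (hE : IsLocalHomeomorph fun e : E => e.1.1) (hc : IsClosed E) (x₀ : U) :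
    Tendsto (fun q : ι × U => s q.1 q.2) (cofinite ×ˢ 𝓝 x₀) (cocompact Y) := by
  refine tendsto_cocompact_of_disjoint_nhds fun y₀ => ?_
  obtain ⟨S, hS, index_mem⟩ := hs.exists_finite_index hE hc x₀ y₀
  rw [nhds_prod_eq] at index_mem
  obtain ⟨P, hP, Q, hQ, hPQ⟩ := eventually_prod_iff.1 index_mem
  refine disjoint_of_disjoint_of_mem (disjoint_compl_right (a := {y | Q y})) hQ
    (mem_map.2 ?_)
  filter_upwards [hS.eventually_cofinite_notMem.prod_mk hP] with q hq hQq
  exact hq.1 (hPQ hq.2 hQq q.1 rfl)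

end IsSheetFamily

theorem exists_isSheetFamily {x : X} [TopologicalSpace ι]
    (h : IsEvenlyCovered (fun e : E => e.1.1) x ι) :
    ∃ (U : Opens X) (s : ι → U → Y), x ∈ U ∧ IsSheetFamily E U s := by
  obtain ⟨-, W, hxW, hW, -, H, hH⟩ := h
  let σ : ι → W → (fun e : E => e.1.1) ⁻¹' W := fun i x => H.symm (x, i)
  have σ_base (i : ι) (x : W) : (σ i x).1.1.1 = x :=
    (hH (σ i x)).symm.trans (congrArg (fun p => (p.1 : X)) (H.apply_symm_apply (x, i)))
  have σ_eq (i : ι) (x : W) : (σ i x).1.1 = ((x : X), (σ i x).1.1.2) := Prod.ext (σ_base i x) rfl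
  refine ⟨⟨W, hW⟩, fun i x => (σ i x).1.1.2, hxW, fun i => ?_, fun x i j hij => ?_, fun x y => ?_⟩
  · exact (continuous_snd.comp (continuous_subtype_val.comp continuous_subtype_val)).comp
      (H.symm.continuous.comp (Continuous.prodMk_left i))
  · have σ_injective : σ i x = σ j x := Subtype.ext (Subtype.ext
      ((σ_eq i x).trans ((congrArg (Prod.mk _) hij).trans (σ_eq j x).symm)))
    exact congrArg Prod.snd (H.symm.injective σ_injective)
  · refine ⟨fun hxy => ?_, fun ⟨i, hi⟩ => hi ▸ σ_eq i x ▸ (σ i x).1.2⟩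
    let e : (fun e : E => e.1.1) ⁻¹' W := ⟨⟨((x : X), y), hxy⟩, x.2⟩
    have base_eq : (H e).1 = x := Subtype.ext (hH e)
    have σ_eq_e : σ (H e).2 x = e := H.symm_apply_eq.2 (Prod.ext base_eq.symm rfl)
    exact ⟨(H e).2, congrArg (fun e => e.1.1.2) σ_eq_e⟩

end Sheets

/-! ### Local Weierstrass products -/

section LocalProduct

theorem tendsto_div_sub_cobounded {α 𝕜 : Type*} [NormedField 𝕜] {l : Filter α} {a b : α → 𝕜}
    {b₀ : 𝕜} (ha : Tendsto a l (Bornology.cobounded 𝕜)) (hb : Tendsto b l (𝓝 b₀)) (c : 𝕜) :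
    Tendsto (fun t => b t / (a t - c)) l (𝓝 0) := by
  have inv_tendsto : Tendsto (fun t => (a t - c)⁻¹) l (𝓝 0) :=
    tendsto_inv₀_cobounded.comp ((tendsto_sub_const_cobounded c).comp ha)
  simpa only [mul_zero, div_eq_mul_inv] using hb.mul inv_tendsto

variable {X : Type u} [TopologicalSpace X] {E : Set (X × ℂ)} {U : Opens X} {c : ℂ}

/-- The Weierstrass product with zeros `s n x` and centre `c`, as a function on `U × ℂ`. -/
def sheetProduct (c : ℂ) (s : ℕ → U → ℂ) (p : U × ℂ) : ℂ :=
  weierstrassProduct fun n => (p.2 - c) / (s n p.1 - c)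

namespace IsSheetFamily

variable (hE : IsLocalHomeomorph fun e : E => e.1.1) (hc : IsClosed E)

include hE hc

theorem tendsto_div {ι : Type*} {s : ι → U → ℂ} (hs : IsSheetFamily E U s) (c : ℂ) (p₀ : U × ℂ) :
    Tendsto (fun q : ι × U × ℂ => (q.2.2 - c) / (s q.1 q.2.1 - c)) (cofinite ×ˢ 𝓝 p₀) (𝓝 0) := by
  refine tendsto_div_sub_cobounded ?_
    (((continuous_snd.sub continuous_const).tendsto p₀).comp tendsto_snd) c
  rw [Metric.cobounded_eq_cocompact]
  exact (hs.tendsto_cocompact hE hc p₀.1).comp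
    (tendsto_fst.prodMk ((continuous_fst.tendsto p₀).comp tendsto_snd))

theorem tendsto_div_fiber {ι : Type*} {s : ι → U → ℂ} (hs : IsSheetFamily E U s) (c : ℂ) (x : U)
    (z₀ : ℂ) :
    Tendsto (fun q : ι × ℂ => (q.2 - c) / (s q.1 x - c)) (cofinite ×ˢ 𝓝 z₀) (𝓝 0) := by
  have fiber_tendsto : Tendsto (fun q : ι × ℂ => (q.1, (x, q.2))) (cofinite ×ˢ 𝓝 z₀)
      (cofinite ×ˢ 𝓝 (x, z₀)) :=
    tendsto_id.prodMap ((Continuous.prodMk_right x).tendsto z₀)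
  simpa only [Function.comp_def] using (hs.tendsto_div hE hc c (x, z₀)).comp fiber_tendsto

variable {s : ℕ → U → ℂ} (hs : IsSheetFamily E U s)

include hs

theorem hasProd_sheetProduct (c : ℂ) (x : U) (z : ℂ) :
    HasProd (fun n => elementaryFactor (n + 1) ((z - c) / (s n x - c)))
      (sheetProduct c s (x, z)) :=
  hasProd_weierstrassProduct
    ((hs.tendsto_div_fiber hE hc c x z).comp (tendsto_id.prodMk tendsto_const_nhds))

theorem sheetProduct_mem_entireFamilies (hne : ∀ n x, s n x ≠ c) :
    sheetProduct c s ∈ entireFamilies U := by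
  refine ⟨continuous_iff_continuousAt.2 fun p => ?_, fun x => ?_⟩
  · refine continuousAt_weierstrassProduct (fun n => Continuous.continuousAt ?_)
      (hs.tendsto_div hE hc c p)
    exact (continuous_snd.sub continuous_const).div
      (((hs.continuous n).comp continuous_fst).sub continuous_const)
      fun q => sub_ne_zero.2 (hne n q.1)
  · exact differentiable_weierstrassProduct
      (fun n => (differentiable_id.sub_const c).div_const (s n x - c))
      (hs.tendsto_div_fiber hE hc c x)

theorem isLocalRealization_sheetProduct (hne : ∀ n x, s n x ≠ c) :
    IsLocalRealization E U ⟨_, hs.sheetProduct_mem_entireFamilies hE hc hne⟩ := by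
  intro x z
  have sub_ne (n : ℕ) : s n x - c ≠ 0 := sub_ne_zero.2 (hne n x)
  have div_eq_one_iff (n : ℕ) : (z - c) / (s n x - c) = 1 ↔ s n x = z := by
    rw [div_eq_one_iff_eq (sub_ne n), sub_left_inj, eq_comm]
  have zero_iff : sheetProduct c s (x, z) = 0 ↔ ∃ n, s n x = z :=
    (weierstrassProduct_eq_zero_iff
      ((hs.tendsto_div_fiber hE hc c x z).comp (tendsto_id.prodMk tendsto_const_nhds))).trans
      (exists_congr div_eq_one_iff)
  refine ⟨zero_iff.trans (hs.mem_iff x z).symm, fun hz => ?_⟩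
  obtain ⟨m, hm⟩ := zero_iff.1 hz
  refine deriv_weierstrassProduct_ne_zero (m := m)
    (fun n => (differentiable_id.sub_const c).div_const (s n x - c))
    (hs.tendsto_div_fiber hE hc c x) (fun n => ?_) ?_
  · refine (div_eq_one_iff n).trans ?_
    rw [← hm]
    exact (hs.injective x).eq_iff
  · have hasDerivAt_div := ((hasDerivAt_id z).sub_const c).div_const (s m x - c)
    exact ne_of_eq_of_ne hasDerivAt_div.deriv (one_div_ne_zero (sub_ne m))

end IsSheetFamily

theorem IsCountableCovering.isEvenlyCovered (hE : IsCountableCovering E) (x : X) :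
    IsEvenlyCovered (fun e : E => e.1.1) x ℕ := by
  have hx := hE.1 x
  have := hx.1
  let fiberEquiv : {z | (x, z) ∈ E} ≃ (fun e : E => e.1.1) ⁻¹' {x} :=
    { toFun := fun z => ⟨⟨(x, z.1), z.2⟩, rfl⟩
      invFun := fun e => ⟨e.1.1.2, (show e.1.1 = (x, e.1.1.2) from Prod.ext e.2 rfl) ▸ e.1.2⟩
      left_inv := fun _ => rfl
      right_inv := fun e => Subtype.ext (Subtype.ext (Prod.ext (Eq.symm e.2) rfl)) }
  have : Countable {z | (x, z) ∈ E} := (hE.2 x).1.to_subtype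
  have : Infinite {z | (x, z) ∈ E} := (hE.2 x).2.to_subtype
  obtain ⟨indexEquiv⟩ := nonempty_equiv_of_countable (α := {z | (x, z) ∈ E}) (β := ℕ)
  exact hx.of_fiber_homeomorph ⟨fiberEquiv.symm.trans indexEquiv,
    continuous_of_discreteTopology, continuous_of_discreteTopology⟩

theorem IsClosedEmbeddedCovering.exists_isLocalWeierstrassProduct
    (hE : IsClosedEmbeddedCovering E) (x : X) :
    ∃ (U : Opens X) (F : entireFamilies U), x ∈ U ∧ IsLocalWeierstrassProduct E U F := by
  obtain ⟨hc, hcov⟩ := hE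
  have hloc := hcov.1.isLocalHomeomorph
  obtain ⟨c, hcx⟩ : ∃ c, (x, c) ∉ E := by
    by_contra! h
    exact not_countable_complex ((hcov.2 x).1.mono fun z _ => h z)
  obtain ⟨W, s, hxW, hs⟩ := exists_isSheetFamily (hcov.isEvenlyCovered x)
  let U : Opens X := W ⊓ ⟨{y | (y, c) ∉ E}, hc.isOpen_compl.preimage (Continuous.prodMk_left c)⟩
  have hUW : U ≤ W := inf_le_left
  have hsU := hs.restrict hUW
  have s_ne (n : ℕ) (y : U) : s n (Set.inclusion hUW y) ≠ c := fun h => y.2.2 (h ▸ hsU.mem n y)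
  exact ⟨U, ⟨_, hsU.sheetProduct_mem_entireFamilies hloc hc s_ne⟩, ⟨hxW, hcx⟩, c, _,
    hsU.continuous, hsU.injective, hsU.mem_iff, s_ne, hsU.hasProd_sheetProduct hloc hc c⟩

theorem IsLocalWeierstrassProduct.isLocalRealization (hE : IsClosedEmbeddedCovering E)
    {F : entireFamilies U} (hF : IsLocalWeierstrassProduct E U F) :
    IsLocalRealization E U F := by
  obtain ⟨c, s, continuous, injective, mem_iff, s_ne, hasProd⟩ := hF
  have hs : IsSheetFamily E U s := ⟨continuous, injective, mem_iff⟩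
  have hloc := hE.2.1.isLocalHomeomorph
  have F_eq : F = ⟨_, hs.sheetProduct_mem_entireFamilies hloc hE.1 s_ne⟩ :=
    Subtype.ext (funext fun p =>
      (hasProd p.1 p.2).unique (hs.hasProd_sheetProduct hloc hE.1 c p.1 p.2))
  exact F_eq ▸ hs.isLocalRealization_sheetProduct hloc hE.1 s_ne

end LocalProduct

/-! ### The obstruction class -/

section ObstructionClass

variable {X : Type u} [TopologicalSpace X] {E : Set (X × ℂ)} {U U' : PointCover X}
  {F : ∀ x, entireFamilies (U.set x)} {F' : ∀ x, entireFamilies (U'.set x)} {a a' : H2Z X}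

theorem IsRatioClass.eq (h : IsRatioClass U F a) (h' : IsRatioClass U' F' a')
    (hF : ∀ x, IsLocalRealization E (U.set x) (F x))
    (hF' : ∀ x, IsLocalRealization E (U'.set x) (F' x)) : a = a' := by
  obtain ⟨γ, hγ, hc⟩ := h
  obtain ⟨γ', hγ', hc'⟩ := h'
  rw [← hγ.cechClass_eq hγ' hF hF'] at hc'
  exact hc.unique twoPiI_injective exact_twoPiI_expMap hc'

theorem IsRealizable.exists_isRatioClass_zero (hE : IsRealizable E) :
    ∃ (U : PointCover X) (F : ∀ x, entireFamilies (U.set x)),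
      (∀ x, IsLocalRealization E (U.set x) (F x)) ∧ IsRatioClass U F 0 := by
  obtain ⟨F, hF⟩ := hE.exists_isLocalRealization_top
  refine ⟨⟨fun _ => ⊤, fun _ => trivial⟩, fun _ => F, fun _ => hF, 0, isRatioCocycle_zero F, ?_⟩
  rw [map_zero]
  exact isConnecting_zero _ _ 1

variable [T2Space X] [ParacompactSpace X]

theorem exists_isRatioClass (hF : ∀ x, IsLocalRealization E (U.set x) (F x)) :
    ∃ a, IsRatioClass U F a := by
  obtain ⟨γ, hγ⟩ := exists_isRatioCocycle hF
  obtain ⟨a, ha⟩ := exists_isConnecting twoPiI_injective exact_twoPiI_expMap γ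
  exact ⟨a, γ, hγ, ha⟩

theorem IsRatioClass.isRealizable (h : IsRatioClass U F 0) (hE : IsCountableCovering E)
    (hF : ∀ x, IsLocalRealization E (U.set x) (F x)) : IsRealizable E := by
  obtain ⟨γ, hγ, hc⟩ := h
  exact hγ.isRealizable hE hF (hc.eq_zero cocycles_sheafO_le_coboundaries exact_twoPiI_expMap)

theorem isObstructionClass_c1 (hE : IsClosedEmbeddedCovering E) :
    IsObstructionClass E (c1 E) := by
  choose U F hU hF using hE.exists_isLocalWeierstrassProduct
  obtain ⟨a, ha⟩ := exists_isRatioClass (U := ⟨U, hU⟩) fun x => (hF x).isLocalRealization hE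
  exact Classical.epsilon_spec (p := IsObstructionClass E) ⟨a, ⟨U, hU⟩, F, hF, ha⟩

theorem isRatioClass_iff_eq_c1 (hE : IsClosedEmbeddedCovering E)
    (hF : ∀ x, IsLocalRealization E (U.set x) (F x)) : IsRatioClass U F a ↔ a = c1 E := by
  obtain ⟨V, G, hG, hc⟩ := isObstructionClass_c1 hE
  have eq_c1 {b : H2Z X} (hb : IsRatioClass U F b) : b = c1 E :=
    hb.eq hc hF fun x => (hG x).isLocalRealization hE
  refine ⟨eq_c1, ?_⟩
  rintro rfl
  obtain ⟨b, hb⟩ := exists_isRatioClass hF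
  exact eq_c1 hb ▸ hb

theorem isObstructionClass_iff_eq_c1 (hE : IsClosedEmbeddedCovering E) :
    IsObstructionClass E a ↔ a = c1 E := by
  refine ⟨?_, ?_⟩
  · rintro ⟨U, F, hF, ha⟩
    exact (isRatioClass_iff_eq_c1 hE fun x => (hF x).isLocalRealization hE).1 ha
  · rintro rfl
    exact isObstructionClass_c1 hE

theorem isRealizable_iff_c1_eq_zero (hE : IsClosedEmbeddedCovering E) :
    IsRealizable E ↔ c1 E = 0 := by
  refine ⟨fun h => ?_, fun h => ?_⟩
  · obtain ⟨U, F, hF, h0⟩ := h.exists_isRatioClass_zero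
    exact ((isRatioClass_iff_eq_c1 hE hF).1 h0).symm
  · obtain ⟨U, F, hF, hc⟩ := isObstructionClass_c1 hE
    exact (h ▸ hc).isRealizable hE.2 fun x => (hF x).isLocalRealization hE

end ObstructionClass

end WeierstrassCovering

end

open WeierstrassCovering in
theorem mainTheorem5_general {X : Type*} [TopologicalSpace X] [T2Space X] [ParacompactSpace X]
    (E : Set (X × ℂ)) (hE : IsClosedEmbeddedCovering E) :
    (∀ a : H2Z X, IsObstructionClass E a ↔ a = c1 E) ∧
    (∀ (U : PointCover X) (F : ∀ x, entireFamilies (U.set x)),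
      (∀ x, IsLocalRealization E (U.set x) (F x)) →
        ∀ a : H2Z X, IsRatioClass U F a ↔ a = c1 E) ∧
    (IsRealizable E ↔ c1 E = 0) ∧
    (Subsingleton (H2Z X) → IsRealizable E) :=
  ⟨fun _ => isObstructionClass_iff_eq_c1 hE, fun _ _ hF _ => isRatioClass_iff_eq_c1 hE hF,
    isRealizable_iff_c1_eq_zero hE,
    fun _ => (isRealizable_iff_c1_eq_zero hE).2 (Subsingleton.elim _ _)⟩

open WeierstrassCovering in
/-- The first two conjuncts say that the class `c₁(E)` exists and does not depend on the choice of
the cover and of the local realizations. -/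
theorem mainTheorem5 {X : Type*} [TopologicalSpace X] [T2Space X] [ParacompactSpace X]
    (hX : LocallyContractibleSpace X) (E : Set (X × ℂ)) (hE : IsClosedEmbeddedCovering E) :
    (∀ a : H2Z X, IsObstructionClass E a ↔ a = c1 E) ∧
    (∀ (U : PointCover X) (F : ∀ x, entireFamilies (U.set x)),
      (∀ x, IsLocalRealization E (U.set x) (F x)) →
        ∀ a : H2Z X, IsRatioClass U F a ↔ a = c1 E) ∧
    (IsRealizable E ↔ c1 E = 0) ∧
    (Subsingleton (H2Z X) → IsRealizable E) :=
  mainTheorem5_general E hE
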